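/- Let $N\ge 1$ be an integer. For $0<\alpha<1$ let $h_\alpha$ be the probability density on $(0,\infty)$ with $\int_0^\infty e^{z\theta}h_\alpha(\theta)\,d\theta=\sum_{k\ge0} z^k/\Gamma(\alpha k+1)$ for all $z\in\mathbb C$. For $t>0$ and a nonnegative measure $\mu$ on $\mathbb R^N$ put $$e^{t\Delta}\mu(x)=\int_{\mathbb R^N}(4\pi t)^{-N/2}e^{-|x-y|^2/(4t)}\,d\mu(y),\quad P_\alpha(t)\mu=\int_0^\infty h_\alpha(\theta)\,e^{t^\alpha\theta\Delta}\mu\,d\theta,\quad S_\alpha(t)\mu=\int_0^\infty\theta h_\alpha(\theta)\,e^{t^\alpha\theta\Delta}\mu\,d\theta,$$ and identify a nonnegative measurable function $\phi$ with the measure $\phi\,dx$. For $p>1$ and $0<T<\infty$, a solution in $[0,T]\times\mathbb R^N$ of $$\partial_t^\alpha u-\Delta u=u^p,\qquad u(0)=\mu,\qquad(\ast)$$ where $\partial_t^\alpha$ is the Caputo derivative, is a nonnegative measurable function $u$ on $(0,T]\times\mathbb R^N$ such that, for almost all $t\in(0,T]$ and $x\in\mathbb R^N$, $$\infty>u(t,x)=[P_\alpha(t)\mu](x)+\alpha\int_0^t(t-s)^{\alpha-1}[S_\alpha(t-s)u(s)^p](x)\,ds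 .$$ **Theorem.** Let $p>p_F:=1+2/N$ and let $1<r<\infty$ satisfy $\frac{2r}{p-1}<N$. Then for every $\alpha\in(0,1)$ there is a constant $\gamma_3=\gamma_3(N,p,r,\alpha)>0$, such that for every $T>0$ and every nonnegative measurable function $\mu$ on $\mathbb R^N$ with $$\sup_{z\in\mathbb R^N}\Big(\int_{B(z,\sigma)}\mu(y)^r\,dy\Big)^{1/r}\le\gamma_3\,\sigma^{\frac Nr-\frac2{p-1}}\qquad\text{for all }\sigma\in(0,T^{\alpha/2}],$$ problem $(\ast)$ possesses a solution in $[0,T]\times\mathbb R^N$. Moreover, the constants can be chosen so that $\limsup_{\alpha\to1^-}\gamma_3(N,p,r,\alpha)\in(0,\infty)$. -/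

import Mathlib

open MeasureTheory Set Filter Topology
open scoped ENNReal

namespace TimeFractional

/-! ### The probability density `h_α` -/

/-- The function `A(φ) = sin((1-α)φ) (sin αφ)^{α/(1-α)} / (sin φ)^{1/(1-α)}`, `0 < φ < π`, of
Zolotarev's integral representation of the one-sided `α`-stable density. -/
noncomputable def zolotarevA (α φ : ℝ) : ℝ :=
  Real.sin ((1 - α) * φ) * Real.sin (α * φ) ^ (α / (1 - α)) / Real.sin φ ^ (1 / (1 - α))

/-- The probability density `h_α` on `(0,∞)`, `0 < α < 1` (the M-Wright function), built explicitly: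
`h_α(θ) = (π(1-α))⁻¹ θ^{α/(1-α)} ∫_0^π A(φ) exp(-A(φ) θ^{1/(1-α)}) dφ`.
Equivalently `h_α(θ) = α⁻¹ θ^{-1-1/α} f_α(θ^{-1/α})` with `f_α` the one-sided `α`-stable density.
That this is the right function is proved below: it is positive (`hDensity_pos`), its moments are
`∫_0^∞ θ^n h_α(θ) dθ = n! / Γ(αn+1)`, in particular its mass is `1` (`lintegral_pow_mul_hDensity`,
`lintegral_hDensity`), and `∫_0^∞ e^{zθ} h_α(θ) dθ` is the Mittag-Leffler function `E_{α,1}(z)`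
(`lintegral_exp_mul_hDensity`); these moments determine the density up to null sets. -/
noncomputable def hDensity (α θ : ℝ) : ℝ :=
  1 / (Real.pi * (1 - α)) * θ ^ (α / (1 - α)) *
    ∫ φ in (0 : ℝ)..Real.pi,
      zolotarevA α φ * Real.exp (-(zolotarevA α φ * θ ^ (1 / (1 - α))))

/-! ### Operators and solutions

Everything below is nonnegative, so all integrals are taken in `[0,∞]`; there is no integrability
condition and no default value involved. -/

/-- The heat kernel `G(t,x) = (4πt)^{-N/2} exp(-|x|²/(4t))` on `ℝ^N`. -/
noncomputable def heatKernel {N : ℕ} (t : ℝ) (x : EuclideanSpace ℝ (Fin N)) : ℝ :=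
  1 / (4 * Real.pi * t) ^ ((N : ℝ) / 2) * Real.exp (-(‖x‖ ^ 2 / (4 * t)))

/-- `[e^{tΔ} μ](x) = ∫ G(t, x - y) dμ(y)` for a nonnegative measure `μ`. -/
noncomputable def heatSemigroup {N : ℕ} (t : ℝ) (μ : Measure (EuclideanSpace ℝ (Fin N)))
    (x : EuclideanSpace ℝ (Fin N)) : ℝ≥0∞ :=
  ∫⁻ y, ENNReal.ofReal (heatKernel t (x - y)) ∂μ

/-- `[P_α(t) μ](x) = ∫_0^∞ h_α(θ) [e^{t^α θ Δ} μ](x) dθ`. -/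
noncomputable def opP {N : ℕ} (α t : ℝ) (μ : Measure (EuclideanSpace ℝ (Fin N)))
    (x : EuclideanSpace ℝ (Fin N)) : ℝ≥0∞ :=
  ∫⁻ θ in Ioi (0 : ℝ), ENNReal.ofReal (hDensity α θ) * heatSemigroup (t ^ α * θ) μ x

/-- `[S_α(t) μ](x) = ∫_0^∞ θ h_α(θ) [e^{t^α θ Δ} μ](x) dθ`. -/
noncomputable def opS {N : ℕ} (α t : ℝ) (μ : Measure (EuclideanSpace ℝ (Fin N)))
    (x : EuclideanSpace ℝ (Fin N)) : ℝ≥0∞ :=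
  ∫⁻ θ in Ioi (0 : ℝ), ENNReal.ofReal (θ * hDensity α θ) * heatSemigroup (t ^ α * θ) μ x

/-- `u` is a solution in `[0,T] × ℝ^N` of `∂_t^α u - Δu = u^p`, `u(0) = μ`, where `μ` is a nonnegative
measure: `u` is nonnegative and measurable, and for almost all `t ∈ (0,T]` and `x ∈ ℝ^N`
`∞ > u(t,x) = [P_α(t)μ](x) + α ∫_0^t (t-s)^{α-1} [S_α(t-s) u(s)^p](x) ds`,
where the function `u(s)^p` is identified with the measure `u(s)^p dx`. The values of `u` outside
`(0,T] × ℝ^N` play no role. -/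
def IsSolution {N : ℕ} (α p T : ℝ) (μ : Measure (EuclideanSpace ℝ (Fin N)))
    (u : ℝ → EuclideanSpace ℝ (Fin N) → ℝ≥0∞) : Prop :=
  Measurable (Function.uncurry u) ∧
  ∀ᵐ z : ℝ × EuclideanSpace ℝ (Fin N) ∂((volume.restrict (Ioc 0 T)).prod volume),
    u z.1 z.2 < ∞ ∧
    u z.1 z.2 = opP α z.1 μ z.2 +
      ENNReal.ofReal α * ∫⁻ s in Ioo 0 z.1, ENNReal.ofReal ((z.1 - s) ^ (α - 1)) *
        opS α (z.1 - s) (volume.withDensity fun y => u s y ^ p) z.2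

/-! ### Verification of the properties of `h_α`

With `w = (sin αφ / sin (1-α)φ) e^{iφ}` the number `A(φ)^{-(1-α)} = (1+w) w^{-α}` is real; expanding
`(1+w)^n` and integrating over `0 < φ < π` gives the moments. -/

lemma inv_Gamma_eq (x : ℝ) : (Real.Gamma x)⁻¹ = x * (Real.Gamma (x + 1))⁻¹ := by
  rcases eq_or_ne x 0 with rfl | h
  · simp
  · rw [Real.Gamma_add_one h, mul_inv, mul_inv_cancel_left₀ h]

lemma sum_choose_mul_sinc (n : ℕ) (x : ℝ) :
    ∑ k ∈ Finset.range (n + 1), (n.choose k : ℝ) * Real.sinc (Real.pi * (k - x)) =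
      n.factorial * (Real.Gamma (1 + x))⁻¹ * (Real.Gamma (1 + n - x))⁻¹ := by
  induction n generalizing x with
  | zero =>
    rcases eq_or_ne x 0 with rfl | h
    · simp
    · have h1 : Real.pi * x ≠ 0 := mul_ne_zero Real.pi_ne_zero h
      have := Real.Gamma_mul_Gamma_one_sub x
      rw [add_comm 1 x, Real.Gamma_add_one h]
      simp only [zero_add, Finset.range_one, Finset.sum_singleton, Nat.choose_self, Nat.cast_one,
        one_mul, Nat.cast_zero, zero_sub, mul_neg, Real.sinc_neg, Real.sinc_of_ne_zero h1,
        Nat.factorial_zero, add_zero]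
      rw [← mul_inv, mul_assoc, this, ← inv_div]
      field_simp
  | succ n ih =>
    have := Finset.sum_choose_succ_mul (fun i _ => Real.sinc (Real.pi * (i - x))) n
    rw [this, ih x]
    have h2 := ih (x - 1)
    have h3 : ∀ k : ℕ, Real.pi * ((k : ℝ) - (x - 1)) = Real.pi * (((k + 1 : ℕ) : ℝ) - x) := by
      intro k; push_cast; ring
    simp only [h3] at h2
    rw [h2, Nat.factorial_succ]
    have e1 := inv_Gamma_eq x
    have e2 := inv_Gamma_eq (1 + n - x)
    rw [show 1 + (x - 1) = x by ring, show 1 + (n : ℝ) - (x - 1) = 1 + n - x + 1 by ring, e1, e2,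
      show (1 : ℝ) + ((n + 1 : ℕ) : ℝ) - x = 1 + n - x + 1 by push_cast; ring, add_comm 1 x]
    push_cast
    ring

lemma sum_rot (n : ℕ) {α φ : ℝ} (h0 : 0 < α) (h1 : α < 1) (hφ : 0 < φ) (hφ' : φ < Real.pi)
    (c : ℝ) :
    ∑ k ∈ Finset.range (n + 1), (n.choose k : ℝ) *
      ((Real.sin (α * φ) / Real.sin ((1 - α) * φ)) ^ ((k : ℝ) - α * n) *
        (Real.cos ((k - α * n) * φ) + c * Real.sin ((k - α * n) * φ))) =
      (Real.sin φ / Real.sin ((1 - α) * φ) *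
        (Real.sin (α * φ) / Real.sin ((1 - α) * φ)) ^ (-α)) ^ n := by
  have s1 : 0 < Real.sin (α * φ) :=
    Real.sin_pos_of_pos_of_lt_pi (by positivity) (by nlinarith)
  have s2 : 0 < Real.sin ((1 - α) * φ) :=
    Real.sin_pos_of_pos_of_lt_pi (mul_pos (by linarith) hφ) (by nlinarith)
  set ρ := Real.sin (α * φ) / Real.sin ((1 - α) * φ) with hρ
  set m := Real.sin φ / Real.sin ((1 - α) * φ) with hm
  have ρ0 : 0 < ρ := div_pos s1 s2
  have hw : (1 : ℂ) + ρ * Complex.exp (φ * Complex.I) = m * Complex.exp (α * φ * Complex.I) := by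
    have hs : Real.sin ((1 - α) * φ) =
        Real.sin φ * Real.cos (α * φ) - Real.cos φ * Real.sin (α * φ) := by
      rw [show (1 - α) * φ = φ - α * φ by ring, Real.sin_sub]
    rw [show (α : ℂ) * φ = ((α * φ : ℝ) : ℂ) by push_cast; rfl]
    apply Complex.ext
    · simp only [Complex.add_re, Complex.one_re, Complex.re_ofReal_mul, Complex.exp_ofReal_mul_I_re]
      rw [hρ, hm, div_mul_eq_mul_div, div_mul_eq_mul_div, eq_div_iff s2.ne', add_mul,
        div_mul_cancel₀ _ s2.ne', hs]
      ring
    · simp only [Complex.add_im, Complex.one_im, Complex.im_ofReal_mul, Complex.exp_ofReal_mul_I_im]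
      rw [hρ, hm]
      field_simp
      ring
  have key : ∑ k ∈ Finset.range (n + 1), (n.choose k : ℂ) *
      (((ρ ^ ((k : ℝ) - α * n) : ℝ) : ℂ) * Complex.exp (((k - α * n) * φ : ℝ) * Complex.I)) =
      (((m * ρ ^ (-α)) ^ n : ℝ) : ℂ) := by
    have e := congrArg (fun z : ℂ => z ^ n * ((ρ ^ (-(α * n)) : ℝ) : ℂ) *
      Complex.exp (((-(α * n)) * φ : ℝ) * Complex.I)) hw
    simp only [add_comm (1 : ℂ), add_pow, Finset.sum_mul] at e
    have r : ((m : ℂ) * Complex.exp (α * φ * Complex.I)) ^ n * ((ρ ^ (-(α * n)) : ℝ) : ℂ) *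
      Complex.exp (((-(α * n)) * φ : ℝ) * Complex.I) = (((m * ρ ^ (-α)) ^ n : ℝ) : ℂ) := by
      rw [mul_pow, ← Complex.exp_nat_mul]
      have : Complex.exp (n * (α * φ * Complex.I)) * Complex.exp (((-(α * n)) * φ : ℝ) * Complex.I)
          = 1 := by
        rw [← Complex.exp_add, ← Complex.exp_zero]; congr 1; push_cast; ring
      have e3 : ρ ^ (-(α * n)) = (ρ ^ (-α)) ^ n := by
        rw [← Real.rpow_natCast, ← Real.rpow_mul ρ0.le]; congr 1; ring
      rw [e3]
      push_cast
      push_cast at this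
      linear_combination (m : ℂ) ^ n * ((ρ ^ (-α) : ℝ) : ℂ) ^ n * this
    rw [r] at e
    rw [← e]
    refine Finset.sum_congr rfl fun k _ => ?_
    have e3 : ρ ^ ((k : ℝ) - α * n) = ρ ^ k * ρ ^ (-(α * n)) := by
      rw [← Real.rpow_natCast, ← Real.rpow_add ρ0]; congr 1
    have e4 : Complex.exp (((k - α * n) * φ : ℝ) * Complex.I) =
        Complex.exp (φ * Complex.I) ^ k * Complex.exp (((-(α * n)) * φ : ℝ) * Complex.I) := by
      rw [← Complex.exp_nat_mul, ← Complex.exp_add]; congr 1; push_cast; ring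
    rw [e3, e4]
    push_cast
    ring
  have kr := congrArg Complex.re key
  have ki := congrArg Complex.im key
  simp only [Complex.re_sum, Complex.im_sum, ← Complex.ofReal_natCast, Complex.re_ofReal_mul,
    Complex.im_ofReal_mul, Complex.exp_ofReal_mul_I_re, Complex.exp_ofReal_mul_I_im,
    Complex.ofReal_re, Complex.ofReal_im] at kr ki
  rw [← kr, ← add_zero (∑ k ∈ Finset.range (n + 1), _ * (_ * Real.cos _)),
    ← mul_zero c, ← ki, Finset.mul_sum, ← Finset.sum_add_distrib]
  refine Finset.sum_congr rfl fun k _ => by ring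

lemma measurable_zolotarevA (α : ℝ) : Measurable (zolotarevA α) := by
  unfold zolotarevA; fun_prop

lemma sin_pos_aux {c φ : ℝ} (h0 : 0 < c) (h1 : c < 1) (hφ : 0 < φ) (hφ' : φ < Real.pi) :
    0 < Real.sin (c * φ) :=
  Real.sin_pos_of_pos_of_lt_pi (by positivity) (by nlinarith)

lemma mul_sin_le_aux {c φ : ℝ} (h0 : 0 < c) (h1 : c < 1) (hφ : 0 < φ) (hφ' : φ < Real.pi) :
    c * Real.sin φ ≤ Real.sin (c * φ) := by
  have := strictConcaveOn_sin_Icc.concaveOn.2 ⟨le_rfl, Real.pi_pos.le⟩ ⟨hφ.le, hφ'.le⟩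
    (sub_nonneg.2 h1.le) h0.le (by ring)
  simpa using this

lemma zolotarevA_pos {α φ : ℝ} (h0 : 0 < α) (h1 : α < 1) (hφ : 0 < φ) (hφ' : φ < Real.pi) :
    0 < zolotarevA α φ := by
  have s1 := sin_pos_aux h0 h1 hφ hφ'
  have s2 := sin_pos_aux (c := 1 - α) (by linarith) (by linarith) hφ hφ'
  have s3 := Real.sin_pos_of_pos_of_lt_pi hφ hφ'
  unfold zolotarevA; positivity

lemma zolotarevA_rpow {α φ : ℝ} (h0 : 0 < α) (h1 : α < 1) (hφ : 0 < φ) (hφ' : φ < Real.pi) :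
    zolotarevA α φ ^ (-(1 - α)) = Real.sin φ / Real.sin ((1 - α) * φ) *
        (Real.sin (α * φ) / Real.sin ((1 - α) * φ)) ^ (-α) := by
  have s1 := sin_pos_aux h0 h1 hφ hφ'
  have s2 := sin_pos_aux (c := 1 - α) (by linarith) (by linarith) hφ hφ'
  have s3 := Real.sin_pos_of_pos_of_lt_pi hφ hφ'
  have ha : (1 - α) ≠ 0 := by linarith
  unfold zolotarevA
  rw [Real.div_rpow (by positivity) (by positivity), Real.mul_rpow s2.le (by positivity),
    ← Real.rpow_mul s1.le, ← Real.rpow_mul s3.le, Real.div_rpow s1.le s2.le,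
    show α / (1 - α) * -(1 - α) = -α by field_simp,
    show 1 / (1 - α) * -(1 - α) = -1 by field_simp, Real.rpow_neg_one]
  rw [show -(1 - α) = -1 - -α by ring, Real.rpow_sub s2, Real.rpow_neg_one]
  field_simp

lemma zolotarevA_rpow_le {α φ : ℝ} (h0 : 0 < α) (h1 : α < 1) (hφ : 0 < φ) (hφ' : φ < Real.pi) :
    zolotarevA α φ ^ (-(1 - α)) ≤ 1 / (α * (1 - α)) := by
  have s1 := sin_pos_aux h0 h1 hφ hφ'
  have s2 := sin_pos_aux (c := 1 - α) (by linarith) (by linarith) hφ hφ'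
  have s3 := Real.sin_pos_of_pos_of_lt_pi hφ hφ'
  have ha : 0 < 1 - α := by linarith
  have m1 : Real.sin φ / Real.sin (α * φ) ≤ 1 / (α * (1 - α)) := by
    rw [div_le_div_iff₀ s1 (by positivity)]
    nlinarith [mul_sin_le_aux h0 h1 hφ hφ', mul_pos h0 (mul_pos s3 h0)]
  have m2 : Real.sin φ / Real.sin ((1 - α) * φ) ≤ 1 / (α * (1 - α)) := by
    rw [div_le_div_iff₀ s2 (by positivity)]
    nlinarith [mul_sin_le_aux ha (by linarith) hφ hφ', mul_pos ha (mul_pos s3 ha)]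
  have e : zolotarevA α φ ^ (-(1 - α)) =
      (Real.sin φ / Real.sin (α * φ)) ^ α * (Real.sin φ / Real.sin ((1 - α) * φ)) ^ (1 - α) := by
    rw [zolotarevA_rpow h0 h1 hφ hφ', Real.div_rpow s1.le s2.le, Real.div_rpow s3.le s1.le,
      Real.div_rpow s3.le s2.le, Real.rpow_neg s1.le, Real.rpow_neg s2.le, Real.rpow_sub s2,
      Real.rpow_sub s3, Real.rpow_one, Real.rpow_one]
    field_simp
  rw [e]
  have c0 : 0 < 1 / (α * (1 - α)) := by positivity
  calc _ ≤ (1 / (α * (1 - α))) ^ α * (1 / (α * (1 - α))) ^ (1 - α) := by gcongr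
    _ = _ := by rw [← Real.rpow_add c0]; simp

lemma integral_zolotarevA_rpow {α : ℝ} (h0 : 0 < α) (h1 : α < 1) (n : ℕ) :
    IntervalIntegrable (fun φ => (zolotarevA α φ ^ (-(1 - α))) ^ n) volume 0 Real.pi ∧
    ∫ φ in (0 : ℝ)..Real.pi, (zolotarevA α φ ^ (-(1 - α))) ^ n =
      Real.pi * (n.factorial * (Real.Gamma (1 + α * n))⁻¹ * (Real.Gamma (1 + n - α * n))⁻¹) := by
  have ha : 0 < 1 - α := by linarith
  have hint : IntervalIntegrable (fun φ => (zolotarevA α φ ^ (-(1 - α))) ^ n) volume 0 Real.pi := by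
    rw [intervalIntegrable_iff_integrableOn_Ioo_of_le Real.pi_pos.le]
    refine Measure.integrableOn_of_bounded (M := (1 / (α * (1 - α))) ^ n) (by simp)
      (((measurable_zolotarevA α).pow_const _).pow_const n).aestronglyMeasurable ?_
    filter_upwards [ae_restrict_mem measurableSet_Ioo] with φ hφ
    have := zolotarevA_pos h0 h1 hφ.1 hφ.2
    rw [Real.norm_of_nonneg (by positivity)]
    exact pow_le_pow_left₀ (by positivity) (zolotarevA_rpow_le h0 h1 hφ.1 hφ.2) n
  refine ⟨hint, ?_⟩
  set ρ : ℝ → ℝ := fun φ => Real.sin (α * φ) / Real.sin ((1 - α) * φ) with hρ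
  set F : ℝ → ℝ := fun φ => ∑ k ∈ Finset.range (n + 1), (n.choose k : ℝ) *
    (ρ φ ^ ((k : ℝ) - α * n) * (φ * Real.sinc ((k - α * n) * φ))) with hF
  have hderiv : ∀ φ ∈ Ioo 0 Real.pi, HasDerivAt F ((zolotarevA α φ ^ (-(1 - α))) ^ n) φ := by
    intro φ hφ
    have s1 := sin_pos_aux h0 h1 hφ.1 hφ.2
    have s2 := sin_pos_aux (c := 1 - α) ha (by linarith) hφ.1 hφ.2
    have ρ0 : 0 < ρ φ := div_pos s1 s2
    obtain ⟨ρ', hρ'⟩ : ∃ d, HasDerivAt ρ d φ := by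
      have : DifferentiableAt ℝ ρ φ :=
        (show DifferentiableAt ℝ (fun φ => Real.sin (α * φ)) φ by fun_prop).fun_div
          (show DifferentiableAt ℝ (fun φ => Real.sin ((1 - α) * φ)) φ by fun_prop) s2.ne'
      exact ⟨_, this.hasDerivAt⟩
    rw [zolotarevA_rpow h0 h1 hφ.1 hφ.2, ← sum_rot n h0 h1 hφ.1 hφ.2 (ρ' / ρ φ)]
    refine HasDerivAt.fun_sum fun k _ => HasDerivAt.const_mul _ ?_
    generalize (k : ℝ) - α * n = s
    change HasDerivAt _ (ρ φ ^ s * _) φ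
    rcases eq_or_ne s 0 with rfl | hs
    · simpa using hasDerivAt_id' φ
    · have d1 : HasDerivAt (fun x => ρ x ^ s * (Real.sin (s * x) / s))
          (ρ' * s * ρ φ ^ (s - 1) * (Real.sin (s * φ) / s) +
            ρ φ ^ s * (Real.cos (s * φ) * (s * 1) / s)) φ :=
        (hρ'.rpow_const (Or.inl ρ0.ne')).mul
          ((((hasDerivAt_id φ).const_mul s).sin).div_const s)
      have e : (fun x => ρ x ^ s * (x * Real.sinc (s * x))) =
          fun x => ρ x ^ s * (Real.sin (s * x) / s) := by
        funext x
        rcases eq_or_ne x 0 with rfl | hx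
        · simp
        · rw [Real.sinc_of_ne_zero (mul_ne_zero hs hx)]; field_simp
      rw [e]
      convert d1 using 1
      rw [Real.rpow_sub_one ρ0.ne']
      field_simp
      ring
  have hlim0 : Tendsto ρ (𝓝[>] 0) (𝓝 (α / (1 - α))) := by
    have t : ∀ c : ℝ, c ≠ 0 → Tendsto (fun φ : ℝ => Real.sinc (c * φ)) (𝓝[>] 0) (𝓝 1) := by
      intro c _
      have : Continuous (fun φ : ℝ => Real.sinc (c * φ)) := by
        have := Real.continuous_sinc; fun_prop
      simpa using (this.tendsto 0).mono_left nhdsWithin_le_nhds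
    have t2 := ((t α h0.ne').const_mul α).div ((t _ ha.ne').const_mul (1 - α)) (by simpa using ha.ne')
    simp only [mul_one] at t2
    refine t2.congr' ?_
    filter_upwards [self_mem_nhdsWithin] with φ (hφ : 0 < φ)
    simp only [Pi.div_apply, hρ]
    rw [Real.sinc_of_ne_zero (by positivity), Real.sinc_of_ne_zero (by positivity)]
    field_simp
  have hc : ∀ s : ℝ, Continuous fun φ : ℝ => φ * Real.sinc (s * φ) := by
    intro s; have := Real.continuous_sinc; fun_prop
  have hF0 : Tendsto F (𝓝[>] 0) (𝓝 0) := by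
    have : Tendsto F (𝓝[>] 0) (𝓝 (∑ k ∈ Finset.range (n + 1), (n.choose k : ℝ) *
        ((α / (1 - α)) ^ ((k : ℝ) - α * n) * (0 * Real.sinc ((k - α * n) * 0))))) := by
      refine tendsto_finsetSum _ fun k _ => Tendsto.const_mul _ (Tendsto.mul ?_ ?_)
      · exact hlim0.rpow_const (Or.inl (by positivity))
      · exact ((hc _).tendsto 0).mono_left nhdsWithin_le_nhds
    simpa using this
  have hρπ : Tendsto ρ (𝓝[<] Real.pi) (𝓝 1) := by
    have s2 : 0 < Real.sin (α * Real.pi) :=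
      Real.sin_pos_of_pos_of_lt_pi (by positivity) (by nlinarith [Real.pi_pos])
    have e : Real.sin ((1 - α) * Real.pi) = Real.sin (α * Real.pi) := by
      rw [← Real.sin_pi_sub]; congr 1; ring
    have : ContinuousAt ρ Real.pi := by
      apply ContinuousAt.div (by fun_prop) (by fun_prop)
      rw [e]; exact s2.ne'
    have h := this.tendsto
    rw [show ρ Real.pi = 1 by simp only [hρ]; rw [e, div_self s2.ne']] at h
    exact h.mono_left nhdsWithin_le_nhds
  have hFπ : Tendsto F (𝓝[<] Real.pi) (𝓝 (∑ k ∈ Finset.range (n + 1), (n.choose k : ℝ) *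
        (1 ^ ((k : ℝ) - α * n) * (Real.pi * Real.sinc ((k - α * n) * Real.pi))))) := by
    refine tendsto_finsetSum _ fun k _ => Tendsto.const_mul _ (Tendsto.mul ?_ ?_)
    · exact hρπ.rpow_const (Or.inl (by positivity))
    · exact ((hc _).tendsto _).mono_left nhdsWithin_le_nhds
  rw [intervalIntegral.integral_eq_sub_of_hasDerivAt_of_tendsto Real.pi_pos hderiv hint hF0 hFπ,
    ← sum_choose_mul_sinc, Finset.mul_sum, sub_zero]
  refine Finset.sum_congr rfl fun k _ => ?_
  rw [Real.one_rpow, mul_comm ((k : ℝ) - α * n)]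
  ring

lemma hDensity_integrable {α θ : ℝ} (h0 : 0 < α) (h1 : α < 1) (hθ : 0 < θ) :
    IntervalIntegrable (fun φ => zolotarevA α φ *
      Real.exp (-(zolotarevA α φ * θ ^ (1 / (1 - α))))) volume 0 Real.pi := by
  rw [intervalIntegrable_iff_integrableOn_Ioo_of_le Real.pi_pos.le]
  have hA := measurable_zolotarevA α
  have hc : 0 < θ ^ (1 / (1 - α)) := Real.rpow_pos_of_pos hθ _
  refine Measure.integrableOn_of_bounded (M := 1 / θ ^ (1 / (1 - α))) (by simp)
    (by fun_prop) ?_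
  filter_upwards [ae_restrict_mem measurableSet_Ioo] with φ hφ
  have := zolotarevA_pos h0 h1 hφ.1 hφ.2
  rw [Real.norm_of_nonneg (by positivity), le_div_iff₀ hc, Real.exp_neg]
  have h := Real.add_one_le_exp (zolotarevA α φ * θ ^ (1 / (1 - α)))
  rw [mul_right_comm, ← div_eq_mul_inv, div_le_one (Real.exp_pos _)]
  linarith

/-- `h_α > 0` on `(0,∞)`. -/
theorem hDensity_pos {α θ : ℝ} (h0 : 0 < α) (h1 : α < 1) (hθ : 0 < θ) : 0 < hDensity α θ := by
  have ha : 0 < 1 - α := by linarith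
  have : 0 < ∫ φ in (0 : ℝ)..Real.pi,
      zolotarevA α φ * Real.exp (-(zolotarevA α φ * θ ^ (1 / (1 - α)))) :=
    intervalIntegral.intervalIntegral_pos_of_pos_on (hDensity_integrable h0 h1 hθ)
      (fun φ hφ => mul_pos (zolotarevA_pos h0 h1 hφ.1 hφ.2) (Real.exp_pos _)) Real.pi_pos
  unfold hDensity
  have := Real.pi_pos
  positivity

/-- The moments of `h_α`: `∫_0^∞ θ^n h_α(θ) dθ = n! / Γ(αn+1)`. -/
theorem lintegral_pow_mul_hDensity {α : ℝ} (h0 : 0 < α) (h1 : α < 1) (n : ℕ) :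
    ∫⁻ θ in Ioi (0 : ℝ), ENNReal.ofReal (θ ^ n * hDensity α θ) =
      ENNReal.ofReal (n.factorial / Real.Gamma (α * n + 1)) := by
  have ha : 0 < 1 - α := by linarith
  have hA := measurable_zolotarevA α
  have hpi := Real.pi_pos
  have hG : 0 < Real.Gamma (n * (1 - α) + 1) := Real.Gamma_pos_of_pos (by positivity)
  let f : ℝ → ℝ → ℝ := fun θ φ => 1 / (Real.pi * (1 - α)) * zolotarevA α φ *
    (θ ^ (n + α / (1 - α)) * Real.exp (-zolotarevA α φ * θ ^ (1 / (1 - α))))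
  have e1 : ∀ θ ∈ Ioi (0 : ℝ), ENNReal.ofReal (θ ^ n * hDensity α θ) =
      ∫⁻ φ in Ioo 0 Real.pi, ENNReal.ofReal (f θ φ) := by
    intro θ (hθ : 0 < θ)
    have e : θ ^ n * hDensity α θ = ∫ φ in Ioo 0 Real.pi, f θ φ := by
      unfold hDensity
      rw [intervalIntegral.integral_of_le hpi.le, integral_Ioc_eq_integral_Ioo, ← mul_assoc,
        ← integral_const_mul]
      refine integral_congr_ae (Eventually.of_forall fun φ => ?_)
      simp only [f, Real.rpow_add hθ, Real.rpow_natCast]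
      rw [neg_mul]
      ring
    rw [e, ofReal_integral_eq_lintegral_ofReal]
    · have := ((intervalIntegrable_iff_integrableOn_Ioo_of_le hpi.le).1
        (hDensity_integrable h0 h1 hθ)).const_mul
          (1 / (Real.pi * (1 - α)) * θ ^ (n + α / (1 - α)))
      refine this.congr (Eventually.of_forall fun φ => ?_)
      simp only [f]
      rw [neg_mul]
      ring
    · filter_upwards [ae_restrict_mem measurableSet_Ioo] with φ hφ
      have := zolotarevA_pos h0 h1 hφ.1 hφ.2
      simp only [f, Pi.zero_apply]
      positivity
  rw [setLIntegral_congr_fun measurableSet_Ioi e1, lintegral_lintegral_swap]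
  swap
  · refine Measurable.aemeasurable ?_
    simp only [f, Function.uncurry_def]
    fun_prop
  have e2 : ∀ φ ∈ Ioo 0 Real.pi, ∫⁻ θ in Ioi (0 : ℝ), ENNReal.ofReal (f θ φ) =
      ENNReal.ofReal (1 / Real.pi * Real.Gamma (n * (1 - α) + 1) *
        (zolotarevA α φ ^ (-(1 - α))) ^ n) := by
    intro φ hφ
    have hA0 := zolotarevA_pos h0 h1 hφ.1 hφ.2
    have hp : 0 < 1 / (1 - α) := by positivity
    have hq : (-1 : ℝ) < n + α / (1 - α) := by
      have : (0 : ℝ) ≤ n + α / (1 - α) := by positivity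
      linarith
    have I := integral_rpow_mul_exp_neg_mul_rpow hp hq hA0
    have q1 : (n + α / (1 - α) + 1) / (1 / (1 - α)) = n * (1 - α) + 1 := by field_simp; ring
    have hi : IntegrableOn (fun θ : ℝ => θ ^ (n + α / (1 - α)) *
        Real.exp (-zolotarevA α φ * θ ^ (1 / (1 - α)))) (Ioi 0) := by
      by_contra hcon
      rw [integral_undef hcon, q1] at I
      have : 0 < zolotarevA α φ ^ (-(n + α / (1 - α) + 1) / (1 / (1 - α))) := by positivity
      have : 0 < zolotarevA α φ ^ (-(n + α / (1 - α) + 1) / (1 / (1 - α))) *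
        (1 / (1 / (1 - α))) * Real.Gamma (n * (1 - α) + 1) := by positivity
      linarith
    simp only [f]
    rw [← ofReal_integral_eq_lintegral_ofReal (hi.const_mul _), integral_const_mul, I, neg_div, q1]
    · congr 1
      rw [← Real.rpow_natCast, ← Real.rpow_mul hA0.le,
        show -((n : ℝ) * (1 - α) + 1) = -(1 - α) * n - 1 by ring, Real.rpow_sub_one hA0.ne']
      field_simp
    · filter_upwards [ae_restrict_mem measurableSet_Ioi] with θ (hθ : 0 < θ)
      simp only [Pi.zero_apply]
      positivity
  obtain ⟨J1, J2⟩ := integral_zolotarevA_rpow h0 h1 n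
  rw [intervalIntegrable_iff_integrableOn_Ioo_of_le hpi.le] at J1
  rw [intervalIntegral.integral_of_le hpi.le, integral_Ioc_eq_integral_Ioo] at J2
  rw [setLIntegral_congr_fun measurableSet_Ioo e2,
    ← ofReal_integral_eq_lintegral_ofReal (J1.const_mul _), integral_const_mul, J2]
  · congr 1
    rw [show 1 + (n : ℝ) - α * n = n * (1 - α) + 1 by ring, add_comm 1 (α * (n : ℝ))]
    field_simp
  · filter_upwards [ae_restrict_mem measurableSet_Ioo] with φ hφ
    have := zolotarevA_pos h0 h1 hφ.1 hφ.2
    simp only [Pi.zero_apply]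
    positivity

lemma measurable_hDensity (α : ℝ) : Measurable (hDensity α) := by
  have hA := measurable_zolotarevA α
  have : StronglyMeasurable fun θ : ℝ => ∫ φ in Ioc (0 : ℝ) Real.pi,
      zolotarevA α φ * Real.exp (-(zolotarevA α φ * θ ^ (1 / (1 - α)))) := by
    refine StronglyMeasurable.integral_prod_right
      (f := fun (θ : ℝ) (φ : ℝ) => zolotarevA α φ * Real.exp (-(zolotarevA α φ * θ ^ (1 / (1 - α)))))
      (Measurable.stronglyMeasurable ?_)
    simp only [Function.uncurry_def]
    fun_prop
  unfold hDensity
  simp only [intervalIntegral.integral_of_le Real.pi_pos.le]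
  have := this.measurable
  fun_prop

/-- `h_α` has total mass `1`. -/
theorem lintegral_hDensity {α : ℝ} (h0 : 0 < α) (h1 : α < 1) :
    ∫⁻ θ in Ioi (0 : ℝ), ENNReal.ofReal (hDensity α θ) = 1 := by
  simpa using lintegral_pow_mul_hDensity h0 h1 0

/-- `∫_0^∞ e^{zθ} h_α(θ) dθ = E_{α,1}(z) = ∑_k z^k / Γ(αk+1)`, here for `z ≥ 0`. -/
theorem lintegral_exp_mul_hDensity {α : ℝ} (h0 : 0 < α) (h1 : α < 1) {z : ℝ} (hz : 0 ≤ z) :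
    ∫⁻ θ in Ioi (0 : ℝ), ENNReal.ofReal (Real.exp (z * θ) * hDensity α θ) =
      ∑' k : ℕ, ENNReal.ofReal (z ^ k / Real.Gamma (α * k + 1)) := by
  have e : ∀ θ ∈ Ioi (0 : ℝ), ENNReal.ofReal (Real.exp (z * θ) * hDensity α θ) =
      ∑' k : ℕ, ENNReal.ofReal (z ^ k / k.factorial) * ENNReal.ofReal (θ ^ k * hDensity α θ) := by
    intro θ (hθ : 0 < θ)
    have hh := hDensity_pos h0 h1 hθ
    have hs : HasSum (fun k : ℕ => (z * θ) ^ k / k.factorial) (Real.exp (z * θ)) := by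
      rw [Real.exp_eq_exp_ℝ]; exact NormedSpace.expSeries_div_hasSum_exp (z * θ)
    have hs2 := hs.mul_right (hDensity α θ)
    rw [← hs2.tsum_eq, ENNReal.ofReal_tsum_of_nonneg (fun k => by positivity) hs2.summable]
    refine tsum_congr fun k => ?_
    rw [← ENNReal.ofReal_mul (by positivity)]
    congr 1
    rw [mul_pow]
    ring
  have hm := measurable_hDensity α
  rw [setLIntegral_congr_fun measurableSet_Ioi e, lintegral_tsum (fun k => by fun_prop)]
  refine tsum_congr fun k => ?_
  rw [lintegral_const_mul _ (by fun_prop), lintegral_pow_mul_hDensity h0 h1,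
    ← ENNReal.ofReal_mul (by positivity)]
  congr 1
  field_simp

end TimeFractional

/-!
Measure data by the local Morrey norm of scale `κ = 2 / (p - 1)`, which the equation leaves
invariant. A heat kernel at time `t` is almost constant at distances below `√t`, so averaging over
balls bounds `e^{tΔ} f` pointwise by the Morrey norm of `f`; interpolating with the trivial bound
gives smoothing from order `q` to order `p > q` at the cost of a negative power of `t`. Integrating
over `θ` transfers this to `P_α` and `S_α`, with constants governed by moments of `h_α` of order
greater than `-1`. These stay bounded uniformly in `α ∈ (0, 1)`, since `A(φ)^{-(1-α)} ≥ sin φ`. In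
the Duhamel term the factor `α` absorbs the singularity `∫ (t-s)^{α(1-d)-1} ds ~ 1 / α`, so small
data keep the Picard iterates below `K t^{-αβ}` with `K` independent of `α`, and their monotone
limit is a solution.
-/

namespace TimeFractional

section Minkowski

variable {A : Type*} [MeasurableSpace A] {m : Measure A} {p : ℝ}

-- Hölder's inequality applied to `f = (f W ^ (-(p-1)/p)) * W ^ ((p-1)/p)`.
lemma rpow_lintegral_le_weighted (hp : 1 ≤ p) {f W : A → ℝ≥0∞} (hf : AEMeasurable f m)
    (hW : AEMeasurable W m) (hW0 : ∀ᵐ a ∂m, W a ≠ 0) (hWtop : ∀ᵐ a ∂m, W a ≠ ∞) :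
    (∫⁻ a, f a ∂m) ^ p ≤ (∫⁻ a, W a ∂m) ^ (p - 1) * ∫⁻ a, W a ^ (1 - p) * f a ^ p ∂m := by
  rcases hp.eq_or_lt with rfl | hp
  · simp
  have hp0 : 0 < p := by linarith
  have : 0 < p - 1 := by linarith
  have hfactor : ∫⁻ a, f a ∂m = ∫⁻ a, (W a ^ ((1 - p) / p) * f a) * W a ^ ((p - 1) / p) ∂m := by
    refine lintegral_congr_ae ?_
    filter_upwards [hW0, hWtop] with a h0 htop
    rw [mul_right_comm, ← ENNReal.rpow_add _ _ h0 htop, ← add_div]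
    simp
  have hHolder := ENNReal.lintegral_mul_le_Lp_mul_Lq m (Real.HolderConjugate.conjExponent hp)
    ((hW.pow_const ((1 - p) / p)).mul hf) (hW.pow_const ((p - 1) / p))
  rw [hfactor]
  refine (ENNReal.rpow_le_rpow hHolder hp0.le).trans_eq ?_
  rw [ENNReal.mul_rpow_of_nonneg _ _ hp0.le, ← ENNReal.rpow_mul, ← ENNReal.rpow_mul, mul_comm]
  congr 1
  · have hexp : (p - 1) / p * p.conjExponent = 1 := by
      unfold Real.conjExponent; field_simp
    simp only [← ENNReal.rpow_mul, hexp, ENNReal.rpow_one]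
    congr 1
    unfold Real.conjExponent; field_simp
  · simp only [Pi.mul_apply, ENNReal.mul_rpow_of_nonneg _ _ hp0.le, ← ENNReal.rpow_mul,
      div_mul_cancel₀ _ hp0.ne', ENNReal.rpow_one]

variable {X : Type*} [MeasurableSpace X] {ν : Measure X}

lemma rpow_lintegral_lintegral_le_of_le [SFinite m] [SFinite ν] (hp : 1 ≤ p)
    {f : A → X → ℝ≥0∞} {W : A → ℝ≥0∞} (hf : Measurable (Function.uncurry f)) (hW : Measurable W)
    (hW0 : ∀ a, W a ≠ 0) (hWtop : ∀ᵐ a ∂m, W a ≠ ∞)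
    (hfW : ∀ a, (∫⁻ x, f a x ^ p ∂ν) ^ p⁻¹ ≤ W a) :
    (∫⁻ x, (∫⁻ a, f a x ∂m) ^ p ∂ν) ^ p⁻¹ ≤ ∫⁻ a, W a ∂m := by
  have hp0 : 0 < p := by linarith
  have hmeas : Measurable fun z : X × A => W z.2 ^ (1 - p) * f z.2 z.1 ^ p := by
    have : Measurable fun z : X × A => f z.2 z.1 := hf.comp measurable_swap
    fun_prop
  rw [ENNReal.rpow_inv_le_iff hp0]
  calc ∫⁻ x, (∫⁻ a, f a x ∂m) ^ p ∂ν
      ≤ ∫⁻ x, (∫⁻ a, W a ∂m) ^ (p - 1) * ∫⁻ a, W a ^ (1 - p) * f a x ^ p ∂m ∂ν :=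
        lintegral_mono fun x => rpow_lintegral_le_weighted hp
          (hf.comp measurable_prodMk_right).aemeasurable hW.aemeasurable (.of_forall hW0) hWtop
    _ = (∫⁻ a, W a ∂m) ^ (p - 1) * ∫⁻ a, W a ^ (1 - p) * ∫⁻ x, f a x ^ p ∂ν ∂m := by
        rw [lintegral_const_mul _ hmeas.lintegral_prod_right',
          lintegral_lintegral_swap hmeas.aemeasurable]
        congr! 3 with a
        exact lintegral_const_mul (W a ^ (1 - p)) ((hf.of_uncurry_left (x := a)).pow_const p)
    _ ≤ (∫⁻ a, W a ∂m) ^ (p - 1) * ∫⁻ a, W a ∂m := by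
        refine mul_le_mul_right (lintegral_mono_ae ?_) _
        filter_upwards [hWtop] with a htop
        calc _ ≤ W a ^ (1 - p) * W a ^ p := by
              gcongr
              exact (ENNReal.rpow_inv_le_iff hp0).1 (hfW a)
          _ = W a := by rw [← ENNReal.rpow_add _ _ (hW0 a) htop]; simp
    _ = (∫⁻ a, W a ∂m) ^ p := by
        conv_lhs => enter [2]; rw [← ENNReal.rpow_one (∫⁻ a, W a ∂m)]
        rw [← ENNReal.rpow_add_of_nonneg _ _ (by linarith) zero_le_one, sub_add_cancel]

lemma rpow_lintegral_lintegral_le [SigmaFinite m] [SFinite ν] (hp : 1 ≤ p)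
    {f : A → X → ℝ≥0∞} (hf : Measurable (Function.uncurry f)) :
    (∫⁻ x, (∫⁻ a, f a x ∂m) ^ p ∂ν) ^ p⁻¹ ≤
      ∫⁻ a, (∫⁻ x, f a x ^ p ∂ν) ^ p⁻¹ ∂m := by
  set W := fun a => (∫⁻ x, f a x ^ p ∂ν) ^ p⁻¹
  have hW : Measurable W :=
    (Measurable.lintegral_prod_right' (hf.pow_const p)).pow_const p⁻¹
  by_cases htop : ∫⁻ a, W a ∂m = ∞
  · exact htop ▸ le_top
  -- The weighted bound needs positive weights, so perturb `W` by a small integrable function.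
  refine le_of_forall_pos_le_add fun ε hε => ?_
  obtain ⟨v, hv0, hv, hvε⟩ := exists_pos_lintegral_lt_of_sigmaFinite m hε.ne'
  calc (∫⁻ x, (∫⁻ a, f a x ∂m) ^ p ∂ν) ^ p⁻¹ ≤ ∫⁻ a, (W a + v a) ∂m := by
        refine rpow_lintegral_lintegral_le_of_le hp hf (by fun_prop) (fun a => ?_) ?_
          fun a => le_self_add
        · simpa using fun _ => (hv0 a).ne'
        · filter_upwards [ae_lt_top hW htop] with a ha
          simpa using ha.ne
    _ = ∫⁻ a, W a ∂m + ∫⁻ a, v a ∂m := lintegral_add_left hW _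
    _ ≤ ∫⁻ a, W a ∂m + ε := by gcongr

end Minkowski

lemma rpow_lintegral_le_of_le {X : Type*} [MeasurableSpace X] {ν : Measure X} {p q : ℝ} (hq : 0 < q)
    (hqp : q ≤ p) {f : X → ℝ≥0∞} (hf : Measurable f) {S : ℝ≥0∞} (hS : ∀ x, f x ≤ S) :
    (∫⁻ y, f y ^ p ∂ν) ^ p⁻¹ ≤ S ^ (1 - q / p) * ((∫⁻ y, f y ^ q ∂ν) ^ q⁻¹) ^ (q / p) := by
  have hp : 0 < p := hq.trans_le hqp
  calc (∫⁻ y, f y ^ p ∂ν) ^ p⁻¹ ≤ (∫⁻ y, S ^ (p - q) * f y ^ q ∂ν) ^ p⁻¹ := by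
        gcongr with y
        calc f y ^ p = f y ^ (p - q) * f y ^ q := by
              rw [← ENNReal.rpow_add_of_nonneg _ _ (by linarith) hq.le, sub_add_cancel]
          _ ≤ S ^ (p - q) * f y ^ q := by gcongr; exact hS y
    _ = S ^ (1 - q / p) * ((∫⁻ y, f y ^ q ∂ν) ^ q⁻¹) ^ (q / p) := by
        simp only [lintegral_const_mul _ (hf.pow_const q),
          ENNReal.mul_rpow_of_nonneg _ _ (inv_pos.2 hp).le, ← ENNReal.rpow_mul]
        congr 2 <;> field_simp

section Morrey

open Metric

variable {X : Type*} [PseudoMetricSpace X] [MeasureSpace X] {p q κ κ' R : ℝ} {f g : X → ℝ≥0∞}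

/-- The local Morrey norm: the least `C` such that `(⨍_{B(z,σ)} f ^ q) ^ (1/q) ≤ C σ ^ (-κ)` for all
balls of radius `σ ≤ R`. Averaging over the balls makes Hölder's inequality hold with constant `1`
and keeps the dimension out of the exponent. -/
noncomputable def morreyNorm (q κ R : ℝ) (f : X → ℝ≥0∞) : ℝ≥0∞ :=
  ⨆ (z : X) (σ ∈ Ioc 0 R), ENNReal.ofReal (σ ^ κ) * (⨍⁻ y in ball z σ, f y ^ q ∂volume) ^ q⁻¹

lemma morreyNorm_le_iff {C : ℝ≥0∞} : morreyNorm q κ R f ≤ C ↔ ∀ (z : X), ∀ σ ∈ Ioc 0 R,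
    ENNReal.ofReal (σ ^ κ) * (⨍⁻ y in ball z σ, f y ^ q ∂volume) ^ q⁻¹ ≤ C := by
  simp only [morreyNorm, iSup_le_iff]

lemma mul_laverage_le_morreyNorm (z : X) {σ : ℝ} (hσ : σ ∈ Ioc 0 R) :
    ENNReal.ofReal (σ ^ κ) * (⨍⁻ y in ball z σ, f y ^ q ∂volume) ^ q⁻¹ ≤ morreyNorm q κ R f :=
  morreyNorm_le_iff.1 le_rfl z σ hσ

lemma morreyNorm_congr_ae (hfg : f =ᵐ[volume] g) : morreyNorm q κ R f = morreyNorm q κ R g := by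
  simp only [morreyNorm, setLAverage_eq]
  congr! 8
  refine lintegral_congr_ae (ae_restrict_of_ae ?_)
  filter_upwards [hfg] with y hy
  rw [hy]

lemma morreyNorm_const_mul (hq : 0 < q) {c : ℝ≥0∞} (hc : c ≠ ∞) :
    morreyNorm q κ R (fun x => c * f x) = c * morreyNorm q κ R f := by
  have hcq : c ^ q ≠ ∞ := ENNReal.rpow_ne_top_of_nonneg hq.le hc
  simp only [morreyNorm, setLAverage_eq', ENNReal.mul_rpow_of_nonneg _ _ hq.le,
    lintegral_const_mul' _ _ hcq, ENNReal.mul_rpow_of_nonneg _ _ (inv_pos.2 hq).le,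
    ENNReal.rpow_rpow_inv hq.ne', ENNReal.mul_iSup, mul_left_comm c]

lemma morreyNorm_add_le (hq : 1 ≤ q) (hf : Measurable f) (hg : Measurable g) :
    morreyNorm q κ R (fun x => f x + g x) ≤ morreyNorm q κ R f + morreyNorm q κ R g := by
  refine morreyNorm_le_iff.2 fun z σ hσ => ?_
  calc ENNReal.ofReal (σ ^ κ) * (⨍⁻ y in ball z σ, (f y + g y) ^ q ∂volume) ^ q⁻¹
      ≤ ENNReal.ofReal (σ ^ κ) * ((⨍⁻ y in ball z σ, f y ^ q ∂volume) ^ q⁻¹ +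
          (⨍⁻ y in ball z σ, g y ^ q ∂volume) ^ q⁻¹) := by
        simp only [setLAverage_eq']
        gcongr
        simpa only [one_div, Pi.add_apply] using
          ENNReal.lintegral_Lp_add_le hf.aemeasurable hg.aemeasurable hq
    _ ≤ morreyNorm q κ R f + morreyNorm q κ R g := by
        rw [mul_add]
        exact add_le_add (mul_laverage_le_morreyNorm z hσ) (mul_laverage_le_morreyNorm z hσ)

lemma morreyNorm_lintegral_le [SFinite (volume : Measure X)] {A : Type*} [MeasurableSpace A]
    {m : Measure A} [SigmaFinite m] (hq : 1 ≤ q) {F : A → X → ℝ≥0∞}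
    (hF : Measurable (Function.uncurry F)) :
    morreyNorm q κ R (fun x => ∫⁻ a, F a x ∂m) ≤ ∫⁻ a, morreyNorm q κ R (F a) ∂m := by
  refine morreyNorm_le_iff.2 fun z σ hσ => ?_
  calc ENNReal.ofReal (σ ^ κ) * (⨍⁻ y in ball z σ, (∫⁻ a, F a y ∂m) ^ q ∂volume) ^ q⁻¹
      ≤ ENNReal.ofReal (σ ^ κ) * ∫⁻ a, (⨍⁻ y in ball z σ, F a y ^ q ∂volume) ^ q⁻¹ ∂m := by
        simp only [setLAverage_eq']
        gcongr
        exact rpow_lintegral_lintegral_le hq hF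
    _ = ∫⁻ a, ENNReal.ofReal (σ ^ κ) * (⨍⁻ y in ball z σ, F a y ^ q ∂volume) ^ q⁻¹ ∂m :=
        (lintegral_const_mul' _ _ ENNReal.ofReal_ne_top).symm
    _ ≤ ∫⁻ a, morreyNorm q κ R (F a) ∂m :=
        lintegral_mono fun a => mul_laverage_le_morreyNorm z hσ

lemma morreyNorm_rpow (hp : 0 < p) :
    morreyNorm q (κ * p) R (fun x => f x ^ p) = morreyNorm (p * q) κ R f ^ p := by
  have hsup (F : X → ℝ → ℝ≥0∞) : (⨆ (z) (σ ∈ Ioc 0 R), F z σ) ^ p =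
      ⨆ (z) (σ ∈ Ioc 0 R), F z σ ^ p := by
    simp only [← ENNReal.orderIsoRpow_apply p hp, OrderIso.map_iSup]
  simp only [morreyNorm, hsup]
  congr! 5 with z σ hσ
  rw [ENNReal.mul_rpow_of_nonneg _ _ hp.le, ← ENNReal.rpow_mul, mul_inv_rev, mul_assoc,
    inv_mul_cancel₀ hp.ne', mul_one,
    ENNReal.ofReal_rpow_of_nonneg (Real.rpow_nonneg hσ.1.le κ) hp.le, ← Real.rpow_mul hσ.1.le]
  simp only [← ENNReal.rpow_mul]

lemma morreyNorm_le_morreyNorm (hq : 0 < q) (hqp : q ≤ p) (hf : Measurable f) :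
    morreyNorm q κ R f ≤ morreyNorm p κ R f := by
  have : 0 < p := hq.trans_le hqp
  refine morreyNorm_le_iff.2 fun z σ hσ => le_trans ?_ (mul_laverage_le_morreyNorm z hσ)
  simp only [setLAverage_eq']
  set ν := (volume (ball z σ))⁻¹ • volume.restrict (ball z σ)
  have hν : ν univ ^ (1 / q - 1 / p) ≤ 1 :=
    ENNReal.rpow_le_one (by simp [ν])
      (sub_nonneg.2 (one_div_le_one_div_of_le hq hqp))
  have hLp := eLpNorm'_le_eLpNorm'_mul_rpow_measure_univ hq hqp (μ := ν)
    hf.aestronglyMeasurable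
  simp only [eLpNorm', enorm_eq_self, one_div] at hLp
  gcongr
  exact hLp.trans (mul_le_of_le_one_right' (by simpa only [one_div] using hν))

lemma morreyNorm_interpolation (hq : 0 < q) (hqp : q ≤ p) (hκ : κ * q = κ' * p) (hf : Measurable f)
    {S : ℝ≥0∞} (hS : ∀ x, f x ≤ S) :
    morreyNorm p κ' R f ≤ S ^ (1 - q / p) * morreyNorm q κ R f ^ (q / p) := by
  have hp : 0 < p := hq.trans_le hqp
  refine morreyNorm_le_iff.2 fun z σ hσ => ?_
  have hσκ : σ ^ κ' = (σ ^ κ) ^ (q / p) := by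
    rw [← Real.rpow_mul hσ.1.le, ← mul_div_assoc, hκ, mul_div_cancel_right₀ _ hp.ne']
  have hqp0 : 0 ≤ q / p := by positivity
  calc ENNReal.ofReal (σ ^ κ') * (⨍⁻ y in ball z σ, f y ^ p ∂volume) ^ p⁻¹
      ≤ ENNReal.ofReal (σ ^ κ) ^ (q / p) *
          (S ^ (1 - q / p) * ((⨍⁻ y in ball z σ, f y ^ q ∂volume) ^ q⁻¹) ^ (q / p)) := by
        rw [hσκ, ← ENNReal.ofReal_rpow_of_nonneg (Real.rpow_nonneg hσ.1.le _) hqp0]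
        gcongr
        exact rpow_lintegral_le_of_le hq hqp hf hS
    _ = S ^ (1 - q / p) * (ENNReal.ofReal (σ ^ κ) *
          (⨍⁻ y in ball z σ, f y ^ q ∂volume) ^ q⁻¹) ^ (q / p) := by
        rw [ENNReal.mul_rpow_of_nonneg _ _ hqp0, mul_left_comm]
    _ ≤ S ^ (1 - q / p) * morreyNorm q κ R f ^ (q / p) := by
        gcongr
        exact mul_laverage_le_morreyNorm z hσ

lemma morreyNorm_iSup_le (hq : 0 < q) {u : ℕ → X → ℝ≥0∞} (hu : ∀ n, Measurable (u n))
    (hmono : Monotone u) :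
    morreyNorm q κ R (fun x => ⨆ n, u n x) ≤ ⨆ n, morreyNorm q κ R (u n) := by
  refine morreyNorm_le_iff.2 fun z σ hσ => ?_
  have hpow (a : ℕ → ℝ≥0∞) {s : ℝ} (hs : 0 < s) : (⨆ n, a n) ^ s = ⨆ n, a n ^ s := by
    simp only [← ENNReal.orderIsoRpow_apply s hs, OrderIso.map_iSup]
  simp only [hpow _ hq, setLAverage_eq']
  rw [lintegral_iSup (fun n => (hu n).pow_const q)
    fun i j hij x => ENNReal.rpow_le_rpow (hmono hij x) hq.le, hpow _ (inv_pos.2 hq),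
    ENNReal.mul_iSup]
  refine iSup_mono fun n => ?_
  rw [← setLAverage_eq']
  exact mul_laverage_le_morreyNorm z hσ

lemma morreyNorm_comp_isometryEquiv_le [BorelSpace X] {e : X ≃ᵢ X} (he : MeasurePreserving e) :
    morreyNorm q κ R (f ∘ e) ≤ morreyNorm q κ R f := by
  refine morreyNorm_le_iff.2 fun z σ hσ =>
    le_trans (le_of_eq ?_) (mul_laverage_le_morreyNorm (e z) hσ)
  have hemb := e.toHomeomorph.measurableEmbedding
  have hball : e ⁻¹' ball (e z) σ = ball z σ := by simp
  rw [setLAverage_eq, setLAverage_eq, ← he.measure_preimage_emb hemb (ball (e z) σ),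
    ← he.setLIntegral_comp_preimage_emb hemb (fun y => f y ^ q) (ball (e z) σ), hball]
  rfl

lemma ae_lt_top_of_morreyNorm_ne_top [ProperSpace X] [BorelSpace X]
    [IsFiniteMeasureOnCompacts (volume : Measure X)] (hq : 0 < q) (hR : 0 < R) (hf : Measurable f)
    (h : morreyNorm q κ R f ≠ ∞) : ∀ᵐ x, f x < ∞ := by
  refine measure_null_of_locally_null _ fun z _ =>
    ⟨_, inter_mem_nhdsWithin _ (ball_mem_nhds z hR), ?_⟩
  have hball : (⨍⁻ y in ball z R, f y ^ q ∂volume) < ∞ := by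
    have hlt := (mul_laverage_le_morreyNorm z ⟨hR, le_rfl⟩).trans_lt h.lt_top
    have hRκ : ENNReal.ofReal (R ^ κ) ≠ 0 := by
      simpa using Real.rpow_pos_of_pos hR κ
    rw [← ENNReal.rpow_lt_top_iff_of_pos (inv_pos.2 hq)]
    exact ENNReal.lt_top_of_mul_ne_top_right hlt.ne hRκ
  rw [setLAverage_eq, ENNReal.div_eq_inv_mul] at hball
  have hfin : ∀ᵐ y ∂volume.restrict (ball z R), f y ^ q < ∞ :=
    ae_lt_top (hf.pow_const q) (ENNReal.lt_top_of_mul_ne_top_right hball.ne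
      (ENNReal.inv_ne_zero.2 measure_ball_lt_top.ne)).ne
  rw [ae_restrict_iff' measurableSet_ball] at hfin
  exact measure_mono_null (t := {y | ¬(y ∈ ball z R → f y ^ q < ∞)})
    (fun y hy hfy => hy.1 ((ENNReal.rpow_lt_top_iff_of_pos hq).1 (hfy hy.2))) hfin

end Morrey

lemma lintegral_laverage_ball_comm {X : Type*} [NormedAddCommGroup X] [MeasureSpace X]
    [BorelSpace X] [SecondCountableTopology X] [SigmaFinite (volume : Measure X)]
    [Measure.IsAddLeftInvariant (volume : Measure X)] {F : X → X → ℝ≥0∞}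
    (hF : Measurable (Function.uncurry F)) (ρ : ℝ) :
    ∫⁻ y, ⨍⁻ w in Metric.ball y ρ, F y w ∂volume =
      ∫⁻ w, ⨍⁻ y in Metric.ball w ρ, F y w ∂volume := by
  have hball (y : X) : volume (Metric.ball y ρ) = volume (Metric.ball (0 : X) ρ) := by
    rw [← measure_preimage_add volume y (Metric.ball y ρ), preimage_add_ball, sub_self]
  set S := {z : X × X | dist z.1 z.2 < ρ}
  have hmeas : Measurable (S.indicator (Function.uncurry F)) :=
    hF.indicator (measurableSet_lt (by fun_prop) measurable_const)
  have hleft (y : X) : ∫⁻ w in Metric.ball y ρ, F y w =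
      ∫⁻ w, S.indicator (Function.uncurry F) (y, w) := by
    rw [← lintegral_indicator measurableSet_ball]
    simp only [indicator, S, Metric.mem_ball', mem_ofPred_eq, Function.uncurry]
  have hright (w : X) : ∫⁻ y in Metric.ball w ρ, F y w =
      ∫⁻ y, S.indicator (Function.uncurry F) (y, w) := by
    rw [← lintegral_indicator measurableSet_ball]
    simp only [indicator, S, Metric.mem_ball, mem_ofPred_eq, Function.uncurry]
  simp only [setLAverage_eq, hball, ENNReal.div_eq_inv_mul, hleft, hright]
  rw [lintegral_const_mul _ hmeas.lintegral_prod_right',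
    lintegral_const_mul _ hmeas.lintegral_prod_left',
    lintegral_lintegral_swap (f := fun y w => S.indicator (Function.uncurry F) (y, w))
      hmeas.aemeasurable]

variable {N : ℕ}

local notation "E" => EuclideanSpace ℝ (Fin N)

section Heat

lemma heatKernel_pos {t : ℝ} (ht : 0 < t) (x : E) : 0 < heatKernel t x := by
  unfold heatKernel
  positivity

@[fun_prop]
lemma measurable_heatKernel {A : Type*} [MeasurableSpace A] {τ : A → ℝ} {ξ : A → E}
    (hτ : Measurable τ) (hξ : Measurable ξ) : Measurable fun a => heatKernel (τ a) (ξ a) := by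
  unfold heatKernel
  fun_prop

lemma lintegral_heatKernel {t : ℝ} (ht : 0 < t) :
    ∫⁻ x : E, ENNReal.ofReal (heatKernel t x) = 1 := by
  have hgauss := GaussianFourier.integral_rexp_neg_mul_sq_norm (V := E)
    (show 0 < 1 / (4 * t) by positivity)
  have hkernel : (heatKernel t : E → ℝ) = fun x =>
      1 / (4 * Real.pi * t) ^ ((N : ℝ) / 2) * Real.exp (-(1 / (4 * t)) * ‖x‖ ^ 2) := by
    funext x
    unfold heatKernel
    congr 2
    ring
  have hintegral : ∫ x : E, heatKernel t x = 1 := by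
    rw [hkernel, integral_const_mul, hgauss, finrank_euclideanSpace_fin,
      show Real.pi / (1 / (4 * t)) = 4 * Real.pi * t by field_simp, one_div,
      inv_mul_cancel₀ (by positivity)]
  rw [← ofReal_integral_eq_lintegral_ofReal (not_imp_comm.1 integral_undef (by simp [hintegral]))
    (.of_forall fun x => (heatKernel_pos ht x).le), hintegral, ENNReal.ofReal_one]

/-- The constant by which the heat kernel may grow when its argument moves by at most `√t` and `t`
is doubled. -/
noncomputable def heatConst (N : ℕ) : ℝ := 2 ^ ((N : ℝ) / 2) * Real.exp (1 / 4)

lemma one_le_heatConst : 1 ≤ heatConst N :=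
  one_le_mul_of_one_le_of_one_le (Real.one_le_rpow one_le_two (by positivity))
    (Real.one_le_exp (by norm_num))

lemma heatKernel_le_of_dist_lt {t ρ : ℝ} (ht : 0 < t) (hρt : ρ ^ 2 ≤ t) {x y w : E}
    (h : dist y w < ρ) :
    heatKernel t (x - y) ≤ heatConst N * heatKernel (2 * t) (x - w) := by
  have hnorm : ‖x - w‖ ^ 2 ≤ 2 * ‖x - y‖ ^ 2 + 2 * t :=
    calc ‖x - w‖ ^ 2 ≤ (‖x - y‖ + ρ) ^ 2 := by
          gcongr
          rw [← dist_eq_norm, ← dist_eq_norm]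
          exact (dist_triangle x y w).trans (by gcongr)
      _ ≤ 2 * ‖x - y‖ ^ 2 + 2 * t := by nlinarith [sq_nonneg (‖x - y‖ - ρ)]
  have hexp : Real.exp (-(‖x - y‖ ^ 2 / (4 * t))) ≤
      Real.exp (1 / 4) * Real.exp (-(‖x - w‖ ^ 2 / (4 * (2 * t)))) := by
    rw [← Real.exp_add, Real.exp_le_exp]
    calc -(‖x - y‖ ^ 2 / (4 * t)) = 1 / 4 + -((2 * ‖x - y‖ ^ 2 + 2 * t) / (4 * (2 * t))) := by
          field_simp
          ring
      _ ≤ 1 / 4 + -(‖x - w‖ ^ 2 / (4 * (2 * t))) := by gcongr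
  unfold heatKernel heatConst
  rw [show 4 * Real.pi * (2 * t) = 2 * (4 * Real.pi * t) by ring,
    Real.mul_rpow two_pos.le (by positivity)]
  calc _ ≤ 1 / (4 * Real.pi * t) ^ ((N : ℝ) / 2) *
        (Real.exp (1 / 4) * Real.exp (-(‖x - w‖ ^ 2 / (4 * (2 * t))))) := by gcongr
    _ = _ := by field_simp

/-- `[e^{tΔ} f](x)` for a nonnegative function `f` in place of a measure. -/
noncomputable def heat (t : ℝ) (f : E → ℝ≥0∞) (x : E) : ℝ≥0∞ :=
  ∫⁻ y, ENNReal.ofReal (heatKernel t (x - y)) * f y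

lemma heatSemigroup_withDensity (t : ℝ) {f : E → ℝ≥0∞} (hf : Measurable f) (x : E) :
    heatSemigroup t (volume.withDensity f) x = heat t f x := by
  have hG : Measurable fun y : E => ENNReal.ofReal (heatKernel t (x - y)) := by fun_prop
  simp only [heatSemigroup, heat, lintegral_withDensity_eq_lintegral_mul _ hf hG, Pi.mul_apply,
    mul_comm]

lemma measurable_heat_comp {A : Type*} [MeasurableSpace A] {τ : A → ℝ} {g : A → E → ℝ≥0∞}
    {ξ : A → E} (hτ : Measurable τ) (hg : Measurable (Function.uncurry g)) (hξ : Measurable ξ) :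
    Measurable fun a => heat (τ a) (g a) (ξ a) :=
  Measurable.lintegral_prod_right' (f := fun z : A × E =>
    ENNReal.ofReal (heatKernel (τ z.1) (ξ z.1 - z.2)) * g z.1 z.2)
    (Measurable.mul (by fun_prop) hg)

lemma measurable_heat (t : ℝ) {f : E → ℝ≥0∞} (hf : Measurable f) : Measurable (heat t f) :=
  measurable_heat_comp measurable_const (hf.comp measurable_snd) measurable_id

lemma heat_eq_lintegral_translate (t : ℝ) (f : E → ℝ≥0∞) (x : E) :
    heat t f x = ∫⁻ w, ENNReal.ofReal (heatKernel t w) * f (x - w) := by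
  rw [heat, ← lintegral_sub_left_eq_self _ x]
  simp only [sub_sub_cancel]

lemma morreyNorm_heat_le_morreyNorm {q κ R t : ℝ} (hq : 1 ≤ q) (ht : 0 < t) {f : E → ℝ≥0∞}
    (hf : Measurable f) : morreyNorm q κ R (heat t f) ≤ morreyNorm q κ R f := by
  have hmeas : Measurable fun z : E × E => ENNReal.ofReal (heatKernel t z.1) * f (z.2 - z.1) := by
    fun_prop
  calc morreyNorm q κ R (heat t f)
      ≤ ∫⁻ w, morreyNorm q κ R fun x => ENNReal.ofReal (heatKernel t w) * f (x - w) := by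
        rw [show heat t f = _ from funext (heat_eq_lintegral_translate t f)]
        exact morreyNorm_lintegral_le hq hmeas
    _ ≤ ∫⁻ w : E, ENNReal.ofReal (heatKernel t w) * morreyNorm q κ R f := by
        gcongr with w
        rw [morreyNorm_const_mul (by linarith) ENNReal.ofReal_ne_top]
        gcongr
        exact morreyNorm_comp_isometryEquiv_le (e := IsometryEquiv.subRight w)
          (measurePreserving_sub_right volume w)
    _ = morreyNorm q κ R f := by
        rw [lintegral_mul_const _ (by fun_prop), lintegral_heatKernel ht, one_mul]

lemma heat_le_morreyNorm {κ R ρ t : ℝ} (hρ : ρ ∈ Ioc 0 R) (hρt : ρ ^ 2 ≤ t) {f : E → ℝ≥0∞}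
    (hf : Measurable f) (x : E) :
    heat t f x ≤ ENNReal.ofReal (heatConst N * ρ ^ (-κ)) * morreyNorm 1 κ R f := by
  have ht : 0 < t := (pow_pos hρ.1 2).trans_le hρt
  have hmass : ∫⁻ w : E, ENNReal.ofReal (heatKernel (2 * t) (x - w)) = 1 := by
    rw [lintegral_sub_left_eq_self (fun w => ENNReal.ofReal (heatKernel (2 * t) w)) x,
      lintegral_heatKernel (by positivity)]
  have haverage (w : E) : ⨍⁻ y in Metric.ball w ρ, f y ∂volume ≤
      ENNReal.ofReal (ρ ^ (-κ)) * morreyNorm 1 κ R f := by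
    have hpos := Real.rpow_pos_of_pos hρ.1 κ
    rw [Real.rpow_neg hρ.1.le, ENNReal.ofReal_inv_of_pos hpos]
    refine (ENNReal.mul_le_iff_le_inv (ENNReal.ofReal_pos.2 hpos).ne' ENNReal.ofReal_ne_top).1 ?_
    simpa only [ENNReal.rpow_one, inv_one] using
      mul_laverage_le_morreyNorm (q := 1) (κ := κ) (f := f) w hρ
  calc heat t f x
      = ∫⁻ y, ⨍⁻ _ in Metric.ball y ρ, ENNReal.ofReal (heatKernel t (x - y)) * f y ∂volume :=
        lintegral_congr fun y => (setLAverage_const (Metric.measure_ball_pos _ _ hρ.1).ne'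
          measure_ball_lt_top.ne _).symm
    _ ≤ ∫⁻ y, ⨍⁻ w in Metric.ball y ρ,
          ENNReal.ofReal (heatConst N * heatKernel (2 * t) (x - w)) * f y ∂volume := by
        refine lintegral_mono fun y => ?_
        simp only [setLAverage_eq]
        refine ENNReal.div_le_div_right (setLIntegral_mono' measurableSet_ball fun w hw => ?_) _
        gcongr
        exact heatKernel_le_of_dist_lt ht hρt (Metric.mem_ball'.1 hw)
    _ = ∫⁻ w, ⨍⁻ y in Metric.ball w ρ,
          ENNReal.ofReal (heatConst N * heatKernel (2 * t) (x - w)) * f y ∂volume := by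
        refine lintegral_laverage_ball_comm (F := fun y w : E =>
          ENNReal.ofReal (heatConst N * heatKernel (2 * t) (x - w)) * f y) ?_ ρ
        simp only [Function.uncurry_def]
        fun_prop
    _ = ∫⁻ w, ENNReal.ofReal (heatConst N) * ENNReal.ofReal (heatKernel (2 * t) (x - w)) *
          ⨍⁻ y in Metric.ball w ρ, f y ∂volume := by
        simp only [setLAverage_eq', lintegral_const_mul _ hf,
          ENNReal.ofReal_mul (zero_le_one.trans one_le_heatConst)]
    _ ≤ ∫⁻ w, ENNReal.ofReal (heatConst N) * ENNReal.ofReal (heatKernel (2 * t) (x - w)) *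
          (ENNReal.ofReal (ρ ^ (-κ)) * morreyNorm 1 κ R f) := by
        gcongr with w
        exact haverage w
    _ = ENNReal.ofReal (heatConst N * ρ ^ (-κ)) * morreyNorm 1 κ R f := by
        rw [lintegral_mul_const _ (by fun_prop), lintegral_const_mul _ (by fun_prop), hmass,
          mul_one, ENNReal.ofReal_mul (zero_le_one.trans one_le_heatConst), mul_assoc]

lemma morreyNorm_heat_le {p q κ κ' R ρ t : ℝ} (hq : 1 ≤ q) (hqp : q ≤ p) (hκ : κ * q = κ' * p)
    (hρ : ρ ∈ Ioc 0 R) (hρt : ρ ^ 2 ≤ t) {f : E → ℝ≥0∞} (hf : Measurable f) :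
    morreyNorm p κ' R (heat t f) ≤
      ENNReal.ofReal (heatConst N * ρ ^ (κ' - κ)) * morreyNorm q κ R f := by
  have ht : 0 < t := (pow_pos hρ.1 2).trans_le hρt
  have hq0 : 0 < q := by linarith
  have hp0 : 0 < p := by linarith
  have hC := one_le_heatConst (N := N)
  have hqp0 : 0 ≤ 1 - q / p := sub_nonneg.2 ((div_le_one hp0).2 hqp)
  set S := ENNReal.ofReal (heatConst N * ρ ^ (-κ)) * morreyNorm q κ R f
  have hS (x : E) : heat t f x ≤ S :=
    (heat_le_morreyNorm hρ hρt hf x).trans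
      (mul_le_mul_right (morreyNorm_le_morreyNorm one_pos hq hf) _)
  have hconst : (heatConst N * ρ ^ (-κ)) ^ (1 - q / p) ≤ heatConst N * ρ ^ (κ' - κ) := by
    have hexp : -κ * (1 - q / p) = κ' - κ := by
      field_simp
      linarith
    rw [Real.mul_rpow (by linarith) (Real.rpow_nonneg hρ.1.le _), ← Real.rpow_mul hρ.1.le, hexp]
    exact mul_le_mul_of_nonneg_right
      (Real.rpow_le_self_of_one_le hC (sub_le_self _ (by positivity))) (Real.rpow_nonneg hρ.1.le _)
  calc morreyNorm p κ' R (heat t f) ≤ S ^ (1 - q / p) * morreyNorm q κ R (heat t f) ^ (q / p) :=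
        morreyNorm_interpolation hq0 hqp hκ (measurable_heat t hf) hS
    _ ≤ S ^ (1 - q / p) * morreyNorm q κ R f ^ (q / p) := by
        gcongr
        exact morreyNorm_heat_le_morreyNorm hq ht hf
    _ = ENNReal.ofReal (heatConst N * ρ ^ (-κ)) ^ (1 - q / p) * morreyNorm q κ R f := by
        rw [ENNReal.mul_rpow_of_nonneg _ _ hqp0, mul_assoc,
          ← ENNReal.rpow_add_of_nonneg _ _ hqp0 (by positivity), sub_add_cancel, ENNReal.rpow_one]
    _ ≤ ENNReal.ofReal (heatConst N * ρ ^ (κ' - κ)) * morreyNorm q κ R f := by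
        rw [ENNReal.ofReal_rpow_of_nonneg
          (mul_nonneg (by linarith) (Real.rpow_nonneg hρ.1.le _)) hqp0]
        gcongr

end Heat

section Subordination

lemma heat_mono (t : ℝ) {f g : E → ℝ≥0∞} (h : f ≤ g) (x : E) : heat t f x ≤ heat t g x :=
  lintegral_mono fun y => mul_le_mul_right (h y) _

lemma heat_iSup (t : ℝ) {f : ℕ → E → ℝ≥0∞} (hf : ∀ n, Measurable (f n)) (hmono : Monotone f)
    (x : E) : heat t (fun y => ⨆ n, f n y) x = ⨆ n, heat t (f n) x := by
  simp only [heat, ENNReal.mul_iSup]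
  exact lintegral_iSup (fun n => by fun_prop) fun i j hij y => mul_le_mul_right (hmono hij y) _

/-- The average of `e^{τθΔ} f` over `θ > 0` against the weight `w`: for `τ = t^α` the weights `h_α`
and `θ h_α` give `P_α(t)` and `S_α(t)`. -/
noncomputable def subord (w : ℝ → ℝ) (τ : ℝ) (f : E → ℝ≥0∞) (x : E) : ℝ≥0∞ :=
  ∫⁻ θ in Ioi (0 : ℝ), ENNReal.ofReal (w θ) * heat (τ * θ) f x

lemma opP_withDensity (α t : ℝ) {f : E → ℝ≥0∞} (hf : Measurable f) (x : E) :
    opP α t (volume.withDensity f) x = subord (hDensity α) (t ^ α) f x := by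
  simp only [opP, subord, heatSemigroup_withDensity _ hf]

lemma opS_withDensity (α t : ℝ) {f : E → ℝ≥0∞} (hf : Measurable f) (x : E) :
    opS α t (volume.withDensity f) x = subord (fun θ => θ * hDensity α θ) (t ^ α) f x := by
  simp only [opS, subord, heatSemigroup_withDensity _ hf]

variable {w : ℝ → ℝ} {τ : ℝ}

lemma measurable_subord_comp {A : Type*} [MeasurableSpace A] (hw : Measurable w) {τ : A → ℝ}
    {g : A → E → ℝ≥0∞} {ξ : A → E} (hτ : Measurable τ) (hg : Measurable (Function.uncurry g))
    (hξ : Measurable ξ) : Measurable fun a => subord w (τ a) (g a) (ξ a) := by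
  refine Measurable.lintegral_prod_right' (f := fun z : A × ℝ =>
    ENNReal.ofReal (w z.2) * heat (τ z.1 * z.2) (g z.1) (ξ z.1)) (Measurable.mul (by fun_prop) ?_)
  exact measurable_heat_comp (by fun_prop)
    (hg.comp (by fun_prop : Measurable fun z : (A × ℝ) × E => (z.1.1, z.2))) (by fun_prop)

lemma measurable_subord (hw : Measurable w) (τ : ℝ) {f : E → ℝ≥0∞} (hf : Measurable f) :
    Measurable (subord w τ f) :=
  measurable_subord_comp hw measurable_const (hf.comp measurable_snd) measurable_id

lemma subord_mono {f g : E → ℝ≥0∞} (h : f ≤ g) (x : E) : subord w τ f x ≤ subord w τ g x :=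
  lintegral_mono fun _ => mul_le_mul_right (heat_mono _ h x) _

lemma subord_iSup (hw : Measurable w) {f : ℕ → E → ℝ≥0∞} (hf : ∀ n, Measurable (f n))
    (hmono : Monotone f) (x : E) :
    subord w τ (fun y => ⨆ n, f n y) x = ⨆ n, subord w τ (f n) x := by
  have hmeas (n : ℕ) : Measurable fun θ => ENNReal.ofReal (w θ) * heat (τ * θ) (f n) x :=
    hw.ennreal_ofReal.mul
      (measurable_heat_comp (by fun_prop) ((hf n).comp measurable_snd) measurable_const)
  simp only [subord, heat_iSup _ hf hmono, ENNReal.mul_iSup]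
  exact lintegral_iSup hmeas fun i j hij θ => mul_le_mul_right (heat_mono _ (hmono hij) x) _

lemma morreyNorm_subord_le {p q κ κ' R : ℝ} (hw : Measurable w) (hq : 1 ≤ q) (hqp : q ≤ p)
    (hκ : κ * q = κ' * p) (hR : 0 ≤ R) (hτ : 0 < τ) (hτR : τ ≤ R ^ 2) {f : E → ℝ≥0∞}
    (hf : Measurable f) :
    morreyNorm p κ' R (subord w τ f) ≤ ENNReal.ofReal (heatConst N * τ ^ ((κ' - κ) / 2)) *
      (∫⁻ θ in Ioi 0, ENNReal.ofReal (w θ) * ENNReal.ofReal (min θ 1 ^ ((κ' - κ) / 2))) *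
        morreyNorm q κ R f := by
  have hheat {θ : ℝ} (hθ : 0 < θ) : morreyNorm p κ' R (heat (τ * θ) f) ≤
      ENNReal.ofReal (heatConst N * τ ^ ((κ' - κ) / 2)) *
        ENNReal.ofReal (min θ 1 ^ ((κ' - κ) / 2)) * morreyNorm q κ R f := by
    have hmin : 0 < min θ 1 := lt_min hθ one_pos
    have hρ : √(τ * min θ 1) ∈ Ioc 0 R := by
      refine ⟨by positivity, Real.sqrt_le_iff.2 ⟨hR, ?_⟩⟩
      exact (mul_le_of_le_one_right hτ.le (min_le_right _ _)).trans hτR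
    have hρθ : √(τ * min θ 1) ^ 2 ≤ τ * θ := by
      rw [Real.sq_sqrt (by positivity)]
      gcongr
      exact min_le_left _ _
    have hC := one_le_heatConst (N := N)
    convert morreyNorm_heat_le hq hqp hκ hρ hρθ hf using 2
    rw [← ENNReal.ofReal_mul (by positivity), mul_assoc, ← Real.mul_rpow hτ.le hmin.le,
      Real.sqrt_eq_rpow, ← Real.rpow_mul (by positivity)]
    congr 3
    ring
  have hmeas : Measurable (Function.uncurry fun θ x => ENNReal.ofReal (w θ) * heat (τ * θ) f x) :=
    (by fun_prop : Measurable fun z : ℝ × E => ENNReal.ofReal (w z.1)).mul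
      (measurable_heat_comp (by fun_prop) (hf.comp measurable_snd) measurable_snd)
  calc morreyNorm p κ' R (subord w τ f)
      ≤ ∫⁻ θ in Ioi 0, morreyNorm p κ' R fun x => ENNReal.ofReal (w θ) * heat (τ * θ) f x :=
        morreyNorm_lintegral_le (hq.trans hqp) hmeas
    _ ≤ ∫⁻ θ in Ioi 0, ENNReal.ofReal (heatConst N * τ ^ ((κ' - κ) / 2)) *
          (ENNReal.ofReal (w θ) * ENNReal.ofReal (min θ 1 ^ ((κ' - κ) / 2))) *
            morreyNorm q κ R f := by
        refine setLIntegral_mono' measurableSet_Ioi fun θ hθ => ?_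
        rw [morreyNorm_const_mul (by linarith) ENNReal.ofReal_ne_top, mul_left_comm, mul_assoc]
        exact mul_le_mul_right (hheat hθ) _
    _ = _ := by
        rw [lintegral_mul_const _ (by fun_prop), lintegral_const_mul _ (by fun_prop)]

end Subordination

section Moments

open scoped NNReal

variable {α : ℝ}

lemma lintegral_rpow_mul_exp_neg_mul_rpow {p q b : ℝ} (hp : 0 < p) (hq : -1 < q) (hb : 0 < b) :
    ∫⁻ x in Ioi (0 : ℝ), ENNReal.ofReal (x ^ q * Real.exp (-b * x ^ p)) =
      ENNReal.ofReal (b ^ (-(q + 1) / p) * (1 / p) * Real.Gamma ((q + 1) / p)) := by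
  rw [← integral_rpow_mul_exp_neg_mul_rpow hp hq hb, ofReal_integral_eq_lintegral_ofReal
    (integrableOn_rpow_mul_exp_neg_mul_rpow hq hp hb)]
  filter_upwards [ae_restrict_mem measurableSet_Ioi] with x (hx : 0 < x)
  simp only [Pi.zero_apply]
  positivity

lemma ofReal_hDensity_eq_lintegral (hα0 : 0 < α) (hα1 : α < 1) {θ : ℝ} (hθ : 0 < θ) :
    ENNReal.ofReal (hDensity α θ) = ∫⁻ φ in Ioo 0 Real.pi,
      ENNReal.ofReal (1 / (Real.pi * (1 - α)) * zolotarevA α φ) *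
        ENNReal.ofReal (θ ^ (α / (1 - α)) *
          Real.exp (-zolotarevA α φ * θ ^ (1 / (1 - α)))) := by
  have : 0 < 1 - α := sub_pos.2 hα1
  have hint := (intervalIntegrable_iff_integrableOn_Ioo_of_le Real.pi_pos.le).1
    (hDensity_integrable hα0 hα1 hθ)
  rw [hDensity, intervalIntegral.integral_of_le Real.pi_pos.le, integral_Ioc_eq_integral_Ioo,
    ← integral_const_mul, ofReal_integral_eq_lintegral_ofReal (hint.const_mul _)]
  · refine setLIntegral_congr_fun measurableSet_Ioo fun φ hφ => ?_
    have := zolotarevA_pos hα0 hα1 hφ.1 hφ.2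
    rw [← ENNReal.ofReal_mul (by positivity), neg_mul]
    ring_nf
  · filter_upwards [ae_restrict_mem measurableSet_Ioo] with φ hφ
    have := zolotarevA_pos hα0 hα1 hφ.1 hφ.2
    simp only [Pi.zero_apply]
    positivity

lemma lintegral_rpow_mul_hDensity (hα0 : 0 < α) (hα1 : α < 1) {x : ℝ} (hx : -1 < x) :
    ∫⁻ θ in Ioi 0, ENNReal.ofReal (θ ^ x * hDensity α θ) =
      ∫⁻ φ in Ioo 0 Real.pi, ENNReal.ofReal
        (Real.Gamma (x * (1 - α) + 1) / Real.pi * (zolotarevA α φ ^ (-(1 - α))) ^ x) := by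
  have hα : 0 < 1 - α := sub_pos.2 hα1
  have hA := measurable_zolotarevA α
  have hx' : -1 < x + α / (1 - α) := by
    have : 0 < α / (1 - α) := by positivity
    linarith
  calc ∫⁻ θ in Ioi 0, ENNReal.ofReal (θ ^ x * hDensity α θ)
      = ∫⁻ θ in Ioi 0, ∫⁻ φ in Ioo 0 Real.pi,
          ENNReal.ofReal (1 / (Real.pi * (1 - α)) * zolotarevA α φ) *
            ENNReal.ofReal (θ ^ (x + α / (1 - α)) *
              Real.exp (-zolotarevA α φ * θ ^ (1 / (1 - α)))) := by
        refine setLIntegral_congr_fun measurableSet_Ioi fun θ (hθ : 0 < θ) => ?_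
        have hθx : 0 ≤ θ ^ x := by positivity
        simp only [Real.rpow_add hθ, mul_assoc, ENNReal.ofReal_mul hθx]
        rw [ofReal_hDensity_eq_lintegral hα0 hα1 hθ, ← lintegral_const_mul _ (by fun_prop)]
        simp only [mul_left_comm]
    _ = ∫⁻ φ in Ioo 0 Real.pi, ∫⁻ θ in Ioi 0,
          ENNReal.ofReal (1 / (Real.pi * (1 - α)) * zolotarevA α φ) *
            ENNReal.ofReal (θ ^ (x + α / (1 - α)) *
              Real.exp (-zolotarevA α φ * θ ^ (1 / (1 - α)))) :=
        lintegral_lintegral_swap (Measurable.aemeasurable (by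
          simp only [Function.uncurry_def]
          fun_prop))
    _ = _ := by
        refine setLIntegral_congr_fun measurableSet_Ioo fun φ hφ => ?_
        have hAφ := zolotarevA_pos hα0 hα1 hφ.1 hφ.2
        simp only [lintegral_const_mul' _ _ ENNReal.ofReal_ne_top,
          lintegral_rpow_mul_exp_neg_mul_rpow (one_div_pos.2 hα) hx' hAφ]
        have hexp : (x + α / (1 - α) + 1) / (1 / (1 - α)) = x * (1 - α) + 1 := by
          field_simp
          ring
        rw [← ENNReal.ofReal_mul (by positivity), neg_div, hexp, ← Real.rpow_mul hAφ.le,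
          show -(x * (1 - α) + 1) = -(1 - α) * x - 1 by ring, Real.rpow_sub_one hAφ.ne']
        congr 1
        field_simp

lemma sin_le_zolotarevA_rpow (hα0 : 0 < α) (hα1 : α < 1) {φ : ℝ} (hφ : φ ∈ Ioo 0 Real.pi) :
    Real.sin φ ≤ zolotarevA α φ ^ (-(1 - α)) := by
  have hsin := Real.sin_pos_of_pos_of_lt_pi hφ.1 hφ.2
  have hsin1 := sin_pos_aux hα0 hα1 hφ.1 hφ.2
  have hsin2 := sin_pos_aux (c := 1 - α) (by linarith) (by linarith) hφ.1 hφ.2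
  rw [zolotarevA_rpow hα0 hα1 hφ.1 hφ.2, Real.div_rpow hsin1.le hsin2.le, Real.rpow_neg hsin1.le,
    Real.rpow_neg hsin2.le]
  have hpow1 : Real.sin (α * φ) ^ α ≤ 1 := Real.rpow_le_one hsin1.le (Real.sin_le_one _) hα0.le
  have hpow2 : Real.sin ((1 - α) * φ) ≤ Real.sin ((1 - α) * φ) ^ α :=
    Real.self_le_rpow_of_le_one hsin2.le (Real.sin_le_one _) hα1.le
  calc Real.sin φ ≤ Real.sin φ * (Real.sin ((1 - α) * φ) ^ α / Real.sin ((1 - α) * φ)) :=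
        le_mul_of_one_le_right hsin.le ((one_le_div hsin2).2 hpow2)
    _ ≤ Real.sin φ * (Real.sin ((1 - α) * φ) ^ α / Real.sin ((1 - α) * φ)) *
          (1 / Real.sin (α * φ) ^ α) :=
        le_mul_of_one_le_right (by positivity) ((one_le_div (by positivity)).2 hpow1)
    _ = _ := by field_simp

lemma lintegral_sin_rpow_lt_top {x : ℝ} (hx : -1 < x) (hx0 : x ≤ 0) :
    ∫⁻ φ in Ioo 0 Real.pi, ENNReal.ofReal (Real.sin φ ^ x) < ∞ := by
  have hint : IntervalIntegrable (fun φ : ℝ => φ ^ x) volume 0 Real.pi :=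
    intervalIntegral.intervalIntegrable_rpow' hx
  have hint' : IntervalIntegrable (fun φ : ℝ => (Real.pi - φ) ^ x) volume 0 Real.pi := by
    simpa only [sub_zero, sub_self] using (hint.comp_sub_left Real.pi).symm
  have hsum := (intervalIntegrable_iff_integrableOn_Ioo_of_le Real.pi_pos.le).1
    ((hint.add hint').const_mul ((2 / Real.pi) ^ x))
  have hhalf {ψ : ℝ} (hψ0 : 0 < ψ) (hψ : ψ ≤ Real.pi / 2) :
      Real.sin ψ ^ x ≤ (2 / Real.pi) ^ x * ψ ^ x := by
    rw [← Real.mul_rpow (by positivity) hψ0.le]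
    exact Real.rpow_le_rpow_of_nonpos (by positivity) (Real.mul_le_sin hψ0.le hψ) hx0
  refine lt_of_le_of_lt ?_ hsum.lintegral_lt_top
  refine setLIntegral_mono' measurableSet_Ioo fun φ hφ => ENNReal.ofReal_le_ofReal ?_
  have hφ0 := hφ.1
  have hφπ := sub_pos.2 hφ.2
  rcases le_total φ (Real.pi / 2) with h | h
  · refine (hhalf hφ0 h).trans ?_
    gcongr
    exact le_add_of_nonneg_right (by positivity)
  · rw [← Real.sin_pi_sub]
    refine (hhalf hφπ (by linarith)).trans ?_
    gcongr
    exact le_add_of_nonneg_left (by positivity)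

lemma exists_lintegral_rpow_mul_hDensity_le {x : ℝ} (hx : -1 < x) (hx0 : x ≤ 0) :
    ∃ C : ℝ≥0, ∀ α : ℝ, 0 < α → α < 1 →
      ∫⁻ θ in Ioi 0, ENNReal.ofReal (θ ^ x * hDensity α θ) ≤ C := by
  set G := max (Real.Gamma (x + 1)) (Real.Gamma 1)
  have hGamma {α : ℝ} (hα0 : 0 < α) (hα1 : α < 1) : Real.Gamma (x * (1 - α) + 1) ≤ G :=
    Real.convexOn_Gamma.le_max_of_mem_Icc (mem_Ioi.2 (by linarith)) (mem_Ioi.2 one_pos)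
      ⟨by nlinarith, by nlinarith⟩
  set S := ∫⁻ φ in Ioo 0 Real.pi, ENNReal.ofReal (Real.sin φ ^ x)
  have hfin : ENNReal.ofReal (G / Real.pi) * S ≠ ∞ :=
    ENNReal.mul_ne_top ENNReal.ofReal_ne_top (lintegral_sin_rpow_lt_top hx hx0).ne
  refine ⟨(ENNReal.ofReal (G / Real.pi) * S).toNNReal, fun α hα0 hα1 => ?_⟩
  rw [ENNReal.coe_toNNReal hfin, lintegral_rpow_mul_hDensity hα0 hα1 hx,
    ← lintegral_const_mul' _ _ ENNReal.ofReal_ne_top]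
  refine setLIntegral_mono' measurableSet_Ioo fun φ hφ => ?_
  have : 0 ≤ G := le_max_of_le_right (Real.Gamma_pos_of_pos one_pos).le
  rw [← ENNReal.ofReal_mul (by positivity)]
  have hsin := Real.sin_pos_of_pos_of_lt_pi hφ.1 hφ.2
  have hA := zolotarevA_pos hα0 hα1 hφ.1 hφ.2
  refine ENNReal.ofReal_le_ofReal (mul_le_mul ?_ ?_ (by positivity) (by positivity))
  · gcongr
    exact hGamma hα0 hα1
  · exact Real.rpow_le_rpow_of_nonpos hsin (sin_le_zolotarevA_rpow hα0 hα1 hφ) hx0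

lemma exists_lintegral_hDensity_mul_min_rpow_le {x : ℝ} (hx : -1 < x) (hx0 : x ≤ 0) :
    ∃ C : ℝ≥0, ∀ α : ℝ, 0 < α → α < 1 →
      ∫⁻ θ in Ioi 0, ENNReal.ofReal (hDensity α θ) * ENNReal.ofReal (min θ 1 ^ x) ≤ C := by
  obtain ⟨C, hC⟩ := exists_lintegral_rpow_mul_hDensity_le hx hx0
  refine ⟨1 + C, fun α hα0 hα1 => ?_⟩
  have hh := measurable_hDensity α
  calc ∫⁻ θ in Ioi 0, ENNReal.ofReal (hDensity α θ) * ENNReal.ofReal (min θ 1 ^ x)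
      ≤ ∫⁻ θ in Ioi 0, (ENNReal.ofReal (hDensity α θ) + ENNReal.ofReal (θ ^ x * hDensity α θ)) := by
        refine setLIntegral_mono' measurableSet_Ioi fun θ (hθ : 0 < θ) => ?_
        have hpos := hDensity_pos hα0 hα1 hθ
        have hθx : 0 < θ ^ x := by positivity
        have hmin : min θ 1 ^ x ≤ 1 + θ ^ x := by
          rcases min_choice θ 1 with h | h <;> rw [h]
          · linarith
          · rw [Real.one_rpow]
            linarith
        rw [← ENNReal.ofReal_mul hpos.le, ← ENNReal.ofReal_add hpos.le (by positivity)]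
        exact ENNReal.ofReal_le_ofReal (by nlinarith)
    _ = 1 + ∫⁻ θ in Ioi 0, ENNReal.ofReal (θ ^ x * hDensity α θ) := by
        rw [lintegral_add_left hh.ennreal_ofReal, lintegral_hDensity hα0 hα1]
    _ ≤ (1 + C : ℝ≥0) := by
        push_cast
        gcongr
        exact hC α hα0 hα1

lemma exists_lintegral_mul_hDensity_mul_min_rpow_le {x : ℝ} (hx : -1 ≤ x) :
    ∃ C : ℝ≥0, ∀ α : ℝ, 0 < α → α < 1 →
      ∫⁻ θ in Ioi 0, ENNReal.ofReal (θ * hDensity α θ) * ENNReal.ofReal (min θ 1 ^ x) ≤ C := by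
  obtain ⟨y, hy, hmin⟩ := Real.exists_isMinOn_Gamma_Ioi
  refine ⟨1 + (1 / Real.Gamma y).toNNReal, fun α hα0 hα1 => ?_⟩
  have hh := measurable_hDensity α
  have hfirst : ∫⁻ θ in Ioi 0, ENNReal.ofReal (θ * hDensity α θ) =
      ENNReal.ofReal (1 / Real.Gamma (α + 1)) := by
    simpa using lintegral_pow_mul_hDensity hα0 hα1 1
  calc ∫⁻ θ in Ioi 0, ENNReal.ofReal (θ * hDensity α θ) * ENNReal.ofReal (min θ 1 ^ x)
      ≤ ∫⁻ θ in Ioi 0, (ENNReal.ofReal (hDensity α θ) + ENNReal.ofReal (θ * hDensity α θ)) := by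
        refine setLIntegral_mono' measurableSet_Ioi fun θ (hθ : 0 < θ) => ?_
        have hpos := hDensity_pos hα0 hα1 hθ
        have hmin : θ * min θ 1 ^ x ≤ 1 + θ := by
          rcases le_total θ 1 with h | h
          · have hmul : θ * θ ^ x = θ ^ (1 + x) := by rw [Real.rpow_add hθ, Real.rpow_one]
            rw [min_eq_left h, hmul]
            linarith [Real.rpow_le_one hθ.le h (show 0 ≤ 1 + x by linarith)]
          · rw [min_eq_right h, Real.one_rpow]
            linarith
        rw [← ENNReal.ofReal_mul (by positivity), ← ENNReal.ofReal_add hpos.le (by positivity)]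
        exact ENNReal.ofReal_le_ofReal (by nlinarith)
    _ = 1 + ENNReal.ofReal (1 / Real.Gamma (α + 1)) := by
        rw [lintegral_add_left hh.ennreal_ofReal, lintegral_hDensity hα0 hα1, hfirst]
    _ ≤ (1 + (1 / Real.Gamma y).toNNReal : ℝ≥0) := by
        push_cast
        have := Real.Gamma_pos_of_pos (one_pos.trans hy.1)
        gcongr
        refine ENNReal.ofReal_le_ofReal (one_div_le_one_div_of_le this (hmin ?_))
        exact add_pos hα0 one_pos

end Moments

section Duhamel

open scoped NNReal

lemma lintegral_Ioo_rpow {x t : ℝ} (hx : -1 < x) (ht : 0 ≤ t) :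
    ∫⁻ s in Ioo 0 t, ENNReal.ofReal (s ^ x) = ENNReal.ofReal (t ^ (x + 1) / (x + 1)) := by
  rw [← ofReal_integral_eq_lintegral_ofReal]
  · rw [← integral_Ioc_eq_integral_Ioo, ← intervalIntegral.integral_of_le ht,
      integral_rpow (Or.inl hx), Real.zero_rpow (by linarith), sub_zero]
  · exact (intervalIntegrable_iff_integrableOn_Ioo_of_le ht).1
      (intervalIntegral.intervalIntegrable_rpow' hx)
  · filter_upwards [ae_restrict_mem measurableSet_Ioo] with s hs
    exact Real.rpow_nonneg hs.1.le _

lemma lintegral_Ioo_comp_sub_left (g : ℝ → ℝ≥0∞) (t : ℝ) :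
    ∫⁻ s in Ioo 0 t, g (t - s) = ∫⁻ s in Ioo 0 t, g s := by
  rw [← lintegral_indicator measurableSet_Ioo, ← lintegral_indicator measurableSet_Ioo,
    ← lintegral_sub_left_eq_self _ t]
  refine lintegral_congr fun s => ?_
  simp only [indicator, mem_Ioo, sub_sub_cancel, sub_pos, sub_lt_self_iff, and_comm]

lemma lintegral_beta_le {x y t : ℝ} (hx : 0 < x) (hy : 0 < y) (ht : 0 < t) :
    ∫⁻ s in Ioo 0 t, ENNReal.ofReal ((t - s) ^ (x - 1) * s ^ (y - 1)) ≤
      ENNReal.ofReal ((1 / x + 1 / y) * t ^ (x + y - 1)) := by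
  have hsplit {s : ℝ} (hs : s ∈ Ioo 0 t) : (t - s) ^ (x - 1) * s ^ (y - 1) ≤
      t ^ (x - 1) * s ^ (y - 1) + t ^ (y - 1) * (t - s) ^ (x - 1) := by
    have hs0 := hs.1
    have hst := sub_pos.2 hs.2
    calc (t - s) ^ (x - 1) * s ^ (y - 1)
        = ((t - s) ^ x * s ^ (y - 1) + s ^ y * (t - s) ^ (x - 1)) / t := by
          rw [eq_div_iff ht.ne', Real.rpow_sub_one hst.ne', Real.rpow_sub_one hs0.ne']
          field_simp
          ring
      _ ≤ (t ^ x * s ^ (y - 1) + t ^ y * (t - s) ^ (x - 1)) / t := by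
          gcongr
          · linarith
          · exact hs.2.le
      _ = t ^ (x - 1) * s ^ (y - 1) + t ^ (y - 1) * (t - s) ^ (x - 1) := by
          rw [Real.rpow_sub_one ht.ne', Real.rpow_sub_one ht.ne']
          ring
  calc ∫⁻ s in Ioo 0 t, ENNReal.ofReal ((t - s) ^ (x - 1) * s ^ (y - 1))
      ≤ ∫⁻ s in Ioo 0 t, (ENNReal.ofReal (t ^ (x - 1)) * ENNReal.ofReal (s ^ (y - 1)) +
          ENNReal.ofReal (t ^ (y - 1)) * ENNReal.ofReal ((t - s) ^ (x - 1))) := by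
        refine setLIntegral_mono' measurableSet_Ioo fun s hs => ?_
        have hs0 := hs.1
        have hst := sub_pos.2 hs.2
        rw [← ENNReal.ofReal_mul (by positivity), ← ENNReal.ofReal_mul (by positivity),
          ← ENNReal.ofReal_add (by positivity) (by positivity)]
        exact ENNReal.ofReal_le_ofReal (hsplit hs)
    _ = ENNReal.ofReal (t ^ (x - 1)) * ENNReal.ofReal (t ^ y / y) +
          ENNReal.ofReal (t ^ (y - 1)) * ENNReal.ofReal (t ^ x / x) := by
        rw [lintegral_add_left (by fun_prop), lintegral_const_mul _ (by fun_prop),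
          lintegral_const_mul _ (by fun_prop),
          lintegral_Ioo_comp_sub_left (fun s => ENNReal.ofReal (s ^ (x - 1))),
          lintegral_Ioo_rpow (by linarith) ht.le, lintegral_Ioo_rpow (by linarith) ht.le,
          sub_add_cancel, sub_add_cancel]
    _ = ENNReal.ofReal ((1 / x + 1 / y) * t ^ (x + y - 1)) := by
        rw [← ENNReal.ofReal_mul (by positivity), ← ENNReal.ofReal_mul (by positivity),
          ← ENNReal.ofReal_add (by positivity) (by positivity), Real.rpow_sub_one ht.ne',
          Real.rpow_sub_one ht.ne', Real.rpow_sub_one ht.ne', Real.rpow_add ht]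
        congr 1
        ring

lemma mul_lintegral_beta_le {α b d t : ℝ} (hα0 : 0 < α) (hα1 : α ≤ 1) (hb : b < 1) (hd : d < 1)
    (ht : 0 < t) :
    ENNReal.ofReal α *
        ∫⁻ s in Ioo 0 t, ENNReal.ofReal ((t - s) ^ (α * (1 - d) - 1) * s ^ (-(α * b))) ≤
      ENNReal.ofReal (1 / (1 - d) + 1 / (1 - b)) * ENNReal.ofReal (t ^ (α * (1 - d - b))) := by
  have hd' := sub_pos.2 hd
  have hb' := sub_pos.2 hb
  have hαb : α * (1 - b) ≤ 1 - α * b := by linarith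
  have hαb0 : 0 < 1 - α * b := (mul_pos hα0 hb').trans_le hαb
  have hbeta := lintegral_beta_le (mul_pos hα0 hd') hαb0 ht
  rw [show α * (1 - d) + (1 - α * b) - 1 = α * (1 - d - b) by ring,
    show 1 - α * b - 1 = -(α * b) by ring] at hbeta
  refine (mul_le_mul_right hbeta _).trans ?_
  rw [← ENNReal.ofReal_mul hα0.le, ← ENNReal.ofReal_mul (by positivity), ← mul_assoc]
  gcongr
  calc α * (1 / (α * (1 - d)) + 1 / (1 - α * b))
      ≤ α * (1 / (α * (1 - d)) + 1 / (α * (1 - b))) := by gcongr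
    _ = 1 / (1 - d) + 1 / (1 - b) := by field_simp

/-- The Duhamel term `α ∫_0^t (t-s)^{α-1} S_α(t-s) v(s) ds`. -/
noncomputable def duhamel (α : ℝ) (v : ℝ → E → ℝ≥0∞) (t : ℝ) (x : E) : ℝ≥0∞ :=
  ENNReal.ofReal α * ∫⁻ s in Ioo 0 t, ENNReal.ofReal ((t - s) ^ (α - 1)) *
    subord (fun θ => θ * hDensity α θ) ((t - s) ^ α) (v s) x

variable {α : ℝ}

lemma measurable_duhamel_integrand {v : ℝ → E → ℝ≥0∞} (hv : Measurable (Function.uncurry v)) :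
    Measurable fun z : (ℝ × E) × ℝ => ENNReal.ofReal ((z.1.1 - z.2) ^ (α - 1)) *
      subord (fun θ => θ * hDensity α θ) ((z.1.1 - z.2) ^ α) (v z.2) z.1.2 :=
  Measurable.mul (by fun_prop) (measurable_subord_comp (measurable_id.mul (measurable_hDensity α))
    (by fun_prop) (hv.comp (by fun_prop : Measurable fun z : ((ℝ × E) × ℝ) × E => (z.1.2, z.2)))
    (by fun_prop))

lemma measurable_duhamel {v : ℝ → E → ℝ≥0∞} (hv : Measurable (Function.uncurry v)) :
    Measurable (Function.uncurry (duhamel α v)) := by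
  have hS : MeasurableSet {z : (ℝ × E) × ℝ | z.2 ∈ Ioo 0 z.1.1} := by
    simp only [mem_Ioo, ofPred_and]
    exact (measurableSet_lt measurable_const measurable_snd).inter
      (measurableSet_lt measurable_snd measurable_fst.fst)
  convert (((measurable_duhamel_integrand (α := α) hv).indicator hS).lintegral_prod_right'
    (ν := volume)).const_mul (ENNReal.ofReal α) using 2 with z
  simp only [Function.uncurry, duhamel]
  rw [← lintegral_indicator measurableSet_Ioo]
  rfl

lemma duhamel_mono {v w : ℝ → E → ℝ≥0∞} (h : v ≤ w) (t : ℝ) (x : E) :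
    duhamel α v t x ≤ duhamel α w t x :=
  mul_le_mul_right (lintegral_mono fun s => mul_le_mul_right (subord_mono (h s) x) _) _

lemma duhamel_iSup {v : ℕ → ℝ → E → ℝ≥0∞} (hv : ∀ n, Measurable (Function.uncurry (v n)))
    (hmono : Monotone v) (t : ℝ) (x : E) :
    duhamel α (fun s y => ⨆ n, v n s y) t x = ⨆ n, duhamel α (v n) t x := by
  have hw := measurable_id.mul (measurable_hDensity α)
  have hsubord (s : ℝ) :
      subord (fun θ => θ * hDensity α θ) ((t - s) ^ α) (fun y => ⨆ n, v n s y) x =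
        ⨆ n, subord (fun θ => θ * hDensity α θ) ((t - s) ^ α) (v n s) x :=
    subord_iSup hw (fun n => (hv n).comp measurable_prodMk_left) (fun i j hij => hmono hij s) x
  simp only [duhamel, hsubord]
  rw [← ENNReal.mul_iSup]
  congr 1
  simp only [ENNReal.mul_iSup]
  exact lintegral_iSup
    (fun n => (measurable_duhamel_integrand (α := α) (hv n)).comp
      (measurable_prodMk_left (x := ((t, x) : ℝ × E))))
    fun i j hij s => mul_le_mul_right (subord_mono (hmono hij s) x) _

variable {p q κ κ' β : ℝ}

lemma morreyNorm_subord_rpow_le {w : ℝ → ℝ} {R t : ℝ} {M : ℝ≥0∞} (hw : Measurable w) (hq : 1 ≤ q)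
    (hqp : q ≤ p) (hκ : κ * q = κ' * p) (hβ : κ - κ' = 2 * β)
    (hM : ∫⁻ θ in Ioi 0, ENNReal.ofReal (w θ) * ENNReal.ofReal (min θ 1 ^ (-β)) ≤ M) (hR : 0 ≤ R)
    (ht : 0 < t) (htR : t ^ α ≤ R ^ 2) {f : E → ℝ≥0∞} (hf : Measurable f) :
    morreyNorm p κ' R (subord w (t ^ α) f) ≤
      ENNReal.ofReal (heatConst N) * M * ENNReal.ofReal (t ^ (-(α * β))) * morreyNorm q κ R f := by
  have hC := one_le_heatConst (N := N)
  have hβ' : (κ' - κ) / 2 = -β := by linarith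
  refine (morreyNorm_subord_le hw hq hqp hκ hR (by positivity) htR hf).trans ?_
  rw [hβ', ENNReal.ofReal_mul (by linarith), ← Real.rpow_mul ht.le, mul_neg, mul_right_comm _ M]
  gcongr

lemma exists_morreyNorm_subord_hDensity_le (N : ℕ) (hq : 1 ≤ q) (hqp : q ≤ p)
    (hκ : κ * q = κ' * p) (hβ : κ - κ' = 2 * β) (hβ0 : 0 ≤ β) (hβ1 : β < 1) :
    ∃ C : ℝ≥0, ∀ α R t : ℝ, 0 < α → α < 1 → 0 ≤ R → 0 < t → t ^ α ≤ R ^ 2 →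
      ∀ f : EuclideanSpace ℝ (Fin N) → ℝ≥0∞, Measurable f →
        morreyNorm p κ' R (subord (hDensity α) (t ^ α) f) ≤
          C * ENNReal.ofReal (t ^ (-(α * β))) * morreyNorm q κ R f := by
  obtain ⟨M, hM⟩ := exists_lintegral_hDensity_mul_min_rpow_le (x := -β) (by linarith) (by linarith)
  refine ⟨(heatConst N).toNNReal * M, fun α R t hα0 hα1 hR ht htR f hf => ?_⟩
  exact ENNReal.coe_mul _ M ▸ morreyNorm_subord_rpow_le (measurable_hDensity α) hq hqp hκ hβ
    (hM α hα0 hα1) hR ht htR hf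

lemma exists_morreyNorm_subord_mul_hDensity_le (N : ℕ) (hq : 1 ≤ q) (hqp : q ≤ p)
    (hκ : κ * q = κ' * p) (hβ : κ - κ' = 2 * β) (hβ1 : β ≤ 1) :
    ∃ C : ℝ≥0, ∀ α R t : ℝ, 0 < α → α < 1 → 0 ≤ R → 0 < t → t ^ α ≤ R ^ 2 →
      ∀ f : EuclideanSpace ℝ (Fin N) → ℝ≥0∞, Measurable f →
        morreyNorm p κ' R (subord (fun θ => θ * hDensity α θ) (t ^ α) f) ≤
          C * ENNReal.ofReal (t ^ (-(α * β))) * morreyNorm q κ R f := by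
  obtain ⟨M, hM⟩ := exists_lintegral_mul_hDensity_mul_min_rpow_le (x := -β) (by linarith)
  refine ⟨(heatConst N).toNNReal * M, fun α R t hα0 hα1 hR ht htR f hf => ?_⟩
  exact ENNReal.coe_mul _ M ▸ morreyNorm_subord_rpow_le (measurable_id.mul (measurable_hDensity α))
    hq hqp hκ hβ (hM α hα0 hα1) hR ht htR hf

lemma morreyNorm_duhamel_le {v : ℝ → E → ℝ≥0∞} (hp : 1 ≤ p) (hv : Measurable (Function.uncurry v))
    (R t : ℝ) :
    morreyNorm p κ R (duhamel α v t) ≤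
      ENNReal.ofReal α * ∫⁻ s in Ioo 0 t, ENNReal.ofReal ((t - s) ^ (α - 1)) *
        morreyNorm p κ R (subord (fun θ => θ * hDensity α θ) ((t - s) ^ α) (v s)) := by
  have hp0 : 0 < p := one_pos.trans_le hp
  have hmeas : Measurable (Function.uncurry fun s x => ENNReal.ofReal ((t - s) ^ (α - 1)) *
      subord (fun θ => θ * hDensity α θ) ((t - s) ^ α) (v s) x) :=
    (measurable_duhamel_integrand hv).comp
      (by fun_prop : Measurable fun z : ℝ × E => ((t, z.2), z.1))
  calc morreyNorm p κ R (duhamel α v t)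
      = ENNReal.ofReal α * morreyNorm p κ R fun x => ∫⁻ s in Ioo 0 t,
          ENNReal.ofReal ((t - s) ^ (α - 1)) *
            subord (fun θ => θ * hDensity α θ) ((t - s) ^ α) (v s) x :=
        morreyNorm_const_mul hp0 ENNReal.ofReal_ne_top
    _ ≤ ENNReal.ofReal α * ∫⁻ s in Ioo 0 t, morreyNorm p κ R fun x =>
          ENNReal.ofReal ((t - s) ^ (α - 1)) *
            subord (fun θ => θ * hDensity α θ) ((t - s) ^ α) (v s) x :=
        mul_le_mul_right (morreyNorm_lintegral_le hp hmeas) _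
    _ = _ := by
        simp only [morreyNorm_const_mul hp0 ENNReal.ofReal_ne_top]

lemma exists_morreyNorm_duhamel_le (N : ℕ) {b d : ℝ} (hp : 1 ≤ p) (hκ : κ * p - κ = 2 * d)
    (hd : d < 1) (hb : b < 1) :
    ∃ C : ℝ≥0, ∀ α R t : ℝ, 0 < α → α < 1 → 0 ≤ R → 0 < t → t ^ α ≤ R ^ 2 →
      ∀ (v : ℝ → EuclideanSpace ℝ (Fin N) → ℝ≥0∞) (L : ℝ≥0∞), Measurable (Function.uncurry v) →
        (∀ s ∈ Ioo 0 t, morreyNorm 1 (κ * p) R (v s) ≤ L * ENNReal.ofReal (s ^ (-(α * b)))) →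
          morreyNorm p κ R (duhamel α v t) ≤ C * L * ENNReal.ofReal (t ^ (α * (1 - d - b))) := by
  obtain ⟨C, hC⟩ :=
    exists_morreyNorm_subord_mul_hDensity_le N le_rfl hp (mul_one (κ * p)) hκ hd.le
  refine ⟨C * (1 / (1 - d) + 1 / (1 - b)).toNNReal, fun α R t hα0 hα1 hR ht htR v L hv hL => ?_⟩
  have hintegrand {s : ℝ} (hs : s ∈ Ioo 0 t) : ENNReal.ofReal ((t - s) ^ (α - 1)) *
      morreyNorm p κ R (subord (fun θ => θ * hDensity α θ) ((t - s) ^ α) (v s)) ≤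
        C * L * ENNReal.ofReal ((t - s) ^ (α * (1 - d) - 1) * s ^ (-(α * b))) := by
    have hst := sub_pos.2 hs.2
    have hτ : (t - s) ^ α ≤ R ^ 2 :=
      (Real.rpow_le_rpow hst.le (sub_le_self _ hs.1.le) hα0.le).trans htR
    calc _ ≤ ENNReal.ofReal ((t - s) ^ (α - 1)) *
          (C * ENNReal.ofReal ((t - s) ^ (-(α * d))) * (L * ENNReal.ofReal (s ^ (-(α * b))))) := by
          gcongr
          exact (hC α R _ hα0 hα1 hR hst hτ _ (hv.comp measurable_prodMk_left)).trans
            (mul_le_mul_right (hL s hs) _)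
      _ = _ := by
          rw [show α * (1 - d) - 1 = (α - 1) + -(α * d) by ring, Real.rpow_add hst,
            ENNReal.ofReal_mul (by positivity), ENNReal.ofReal_mul (by positivity)]
          ring
  calc morreyNorm p κ R (duhamel α v t)
      ≤ ENNReal.ofReal α * ∫⁻ s in Ioo 0 t,
          C * L * ENNReal.ofReal ((t - s) ^ (α * (1 - d) - 1) * s ^ (-(α * b))) :=
        (morreyNorm_duhamel_le hp hv R t).trans <| mul_le_mul_right
          (setLIntegral_mono' measurableSet_Ioo fun s hs => hintegrand hs) _
    _ = C * L * (ENNReal.ofReal α *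
          ∫⁻ s in Ioo 0 t, ENNReal.ofReal ((t - s) ^ (α * (1 - d) - 1) * s ^ (-(α * b)))) := by
        rw [lintegral_const_mul _ (by fun_prop), mul_left_comm]
    _ ≤ C * L * (ENNReal.ofReal (1 / (1 - d) + 1 / (1 - b)) *
          ENNReal.ofReal (t ^ (α * (1 - d - b)))) :=
        mul_le_mul_right (mul_lintegral_beta_le hα0 hα1.le hb hd ht) _
    _ = _ := by
        simp only [ENNReal.coe_mul, ENNReal.ofReal]
        ring

end Duhamel

section Picard

open scoped NNReal

/-- The Picard iterates of the integral equation for `∂_t^α u - Δu = u^p`, `u(0) = f`, started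
from `0`. -/
noncomputable def picard (α p : ℝ) (f : E → ℝ≥0∞) : ℕ → ℝ → E → ℝ≥0∞
  | 0 => fun _ _ => 0
  | n + 1 => fun t x => subord (hDensity α) (t ^ α) f x +
      duhamel α (fun s y => picard α p f n s y ^ p) t x

/-- The pointwise limit of the Picard iterates, a solution of the integral equation with values in
`[0, ∞]`. -/
noncomputable def picardLimit (α p : ℝ) (f : E → ℝ≥0∞) (t : ℝ) (x : E) : ℝ≥0∞ :=
  ⨆ n, picard α p f n t x

variable {α p : ℝ} {f : EuclideanSpace ℝ (Fin N) → ℝ≥0∞}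

lemma measurable_picard (hf : Measurable f) (n : ℕ) :
    Measurable (Function.uncurry (picard α p f n)) := by
  induction n with
  | zero => exact measurable_const
  | succ n ih =>
    have hsubord : Measurable fun z : ℝ × E => subord (hDensity α) (z.1 ^ α) f z.2 :=
      measurable_subord_comp (measurable_hDensity α) (measurable_fst.pow_const α)
        (hf.comp measurable_snd) measurable_snd
    exact hsubord.add (measurable_duhamel (ih.pow_const p))

lemma measurable_picardLimit (hf : Measurable f) :
    Measurable (Function.uncurry (picardLimit α p f)) :=
  Measurable.iSup fun n => measurable_picard hf n

lemma monotone_picard (hp : 0 ≤ p) : Monotone (picard α p f) := by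
  refine monotone_nat_of_le_succ fun n => ?_
  induction n with
  | zero => exact fun t x => zero_le
  | succ n ih =>
    exact fun t x =>
      add_le_add_right (duhamel_mono (fun s y => ENNReal.rpow_le_rpow (ih s y) hp) t x) _

lemma picardLimit_eq_add_duhamel (hp : 0 < p) (hf : Measurable f) (t : ℝ) (x : E) :
    picardLimit α p f t x = subord (hDensity α) (t ^ α) f x +
      duhamel α (fun s y => picardLimit α p f s y ^ p) t x := by
  have hpow (s : ℝ) (y : E) : picardLimit α p f s y ^ p = ⨆ n, picard α p f n s y ^ p :=
    (ENNReal.orderIsoRpow p hp).map_iSup _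
  have hmono : Monotone fun n s y => picard α p f n s y ^ p := fun m n h s y =>
    ENNReal.rpow_le_rpow (monotone_picard hp.le h s y) hp.le
  have hmonotx : Monotone fun n => picard α p f n t x := fun m n h => monotone_picard hp.le h t x
  simp only [hpow]
  rw [duhamel_iSup (fun n => (measurable_picard hf n).pow_const p) hmono, ENNReal.add_iSup]
  exact (hmonotx.iSup_nat_add 1).symm

lemma isSolution_picardLimit (hp : 0 < p) (hf : Measurable f) {T : ℝ}
    (hfin : ∀ t ∈ Ioc 0 T, ∀ᵐ x, picardLimit α p f t x < ∞) :
    IsSolution α p T (volume.withDensity f) (picardLimit α p f) := by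
  have hmeas := measurable_picardLimit (α := α) (p := p) hf
  have hlt : ∀ᵐ z : ℝ × E ∂((volume.restrict (Ioc 0 T)).prod volume),
      picardLimit α p f z.1 z.2 < ∞ :=
    (Measure.ae_prod_iff_ae_ae (measurableSet_lt hmeas measurable_const)).2 <| by
      filter_upwards [ae_restrict_mem measurableSet_Ioc] with t ht using hfin t ht
  refine ⟨hmeas, ?_⟩
  filter_upwards [hlt] with z hz
  have hopS (s : ℝ) : opS α (z.1 - s) (volume.withDensity fun y => picardLimit α p f s y ^ p) z.2 =
      subord (fun θ => θ * hDensity α θ) ((z.1 - s) ^ α) (fun y => picardLimit α p f s y ^ p) z.2 :=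
    opS_withDensity _ _ ((hmeas.comp measurable_prodMk_left).pow_const p) _
  refine ⟨hz, ?_⟩
  simp only [opP_withDensity _ _ hf, hopS]
  exact picardLimit_eq_add_duhamel hp hf z.1 z.2

lemma morreyNorm_picard_le {κ R T β : ℝ} {A C K : ℝ≥0} (hp : 1 ≤ p) (hf : Measurable f)
    (hlin : ∀ t ∈ Ioc 0 T, morreyNorm p κ R (subord (hDensity α) (t ^ α) f) ≤
      A * ENNReal.ofReal (t ^ (-(α * β))))
    (hduhamel : ∀ t ∈ Ioc 0 T, ∀ (v : ℝ → E → ℝ≥0∞) (L : ℝ≥0∞), Measurable (Function.uncurry v) →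
      (∀ s ∈ Ioo 0 t, morreyNorm 1 (κ * p) R (v s) ≤ L * ENNReal.ofReal (s ^ (-(α * (β * p))))) →
        morreyNorm p κ R (duhamel α v t) ≤ C * L * ENNReal.ofReal (t ^ (-(α * β))))
    (hK : A + C * K ^ p ≤ K) (n : ℕ) {t : ℝ} (ht : t ∈ Ioc 0 T) :
    morreyNorm p κ R (picard α p f n t) ≤ K * ENNReal.ofReal (t ^ (-(α * β))) := by
  have hp0 : 0 < p := one_pos.trans_le hp
  induction n generalizing t with
  | zero => simp [picard, morreyNorm, ENNReal.zero_rpow_of_pos, hp0]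
  | succ n ih =>
    have hmeas := measurable_picard (α := α) (p := p) hf n
    have hpow (s : ℝ) (hs : s ∈ Ioo 0 t) :
        morreyNorm 1 (κ * p) R (fun y => picard α p f n s y ^ p) ≤
          (K : ℝ≥0∞) ^ p * ENNReal.ofReal (s ^ (-(α * (β * p)))) := by
      rw [morreyNorm_rpow hp0, mul_one]
      refine (ENNReal.rpow_le_rpow (ih ⟨hs.1, hs.2.le.trans ht.2⟩) hp0.le).trans_eq ?_
      rw [ENNReal.mul_rpow_of_nonneg _ _ hp0.le, ENNReal.ofReal_rpow_of_nonneg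
        (Real.rpow_nonneg hs.1.le _) hp0.le, ← Real.rpow_mul hs.1.le,
        show -(α * β) * p = -(α * (β * p)) by ring]
    calc morreyNorm p κ R (picard α p f (n + 1) t)
        ≤ morreyNorm p κ R (subord (hDensity α) (t ^ α) f) +
            morreyNorm p κ R (duhamel α (fun s y => picard α p f n s y ^ p) t) :=
          morreyNorm_add_le hp (measurable_subord (measurable_hDensity α) _ hf)
            ((measurable_duhamel (hmeas.pow_const p)).comp measurable_prodMk_left)
      _ ≤ A * ENNReal.ofReal (t ^ (-(α * β))) +
            C * (K : ℝ≥0∞) ^ p * ENNReal.ofReal (t ^ (-(α * β))) :=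
          add_le_add (hlin t ht) (hduhamel t ht _ _ (hmeas.pow_const p) hpow)
      _ = (A + C * K ^ p : ℝ≥0) * ENNReal.ofReal (t ^ (-(α * β))) := by
          rw [← add_mul, ENNReal.coe_add, ENNReal.coe_mul, ENNReal.coe_rpow_of_nonneg _ hp0.le]
      _ ≤ K * ENNReal.ofReal (t ^ (-(α * β))) := by gcongr

lemma exists_mul_add_mul_rpow_le (hp : 1 < p) (C₁ C₂ : ℝ≥0) :
    ∃ γ K : ℝ≥0, 0 < γ ∧ C₁ * γ + C₂ * K ^ p ≤ K := by
  have hp' : p - 1 ≠ 0 := (sub_pos.2 hp).ne'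
  set K : ℝ≥0 := (2 * (C₂ + 1))⁻¹ ^ (p - 1)⁻¹
  have hK : 0 < K := by positivity
  have hKp : K ^ p = (2 * (C₂ + 1))⁻¹ * K := by
    rw [← NNReal.rpow_inv_rpow hp' (2 * (C₂ + 1))⁻¹, ← NNReal.rpow_add_one hK.ne',
      sub_add_cancel]
  refine ⟨K / (2 * (C₁ + 1)), K, by positivity, ?_⟩
  calc C₁ * (K / (2 * (C₁ + 1))) + C₂ * K ^ p
      = K / 2 * (C₁ / (C₁ + 1)) + K / 2 * (C₂ / (C₂ + 1)) := by
        rw [hKp]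
        field_simp
    _ ≤ K / 2 * 1 + K / 2 * 1 := by
        gcongr <;> exact div_le_one_of_le₀ (le_add_of_nonneg_right zero_le_one) zero_le
    _ = K := by rw [mul_one, add_halves]

lemma exists_morreyNorm_picard_le (N : ℕ) {q : ℝ} (hq : 1 < q) (hqp : q < p) :
    ∃ γ K : ℝ≥0, 0 < γ ∧ ∀ α T : ℝ, 0 < α → α < 1 → 0 < T →
      ∀ f : EuclideanSpace ℝ (Fin N) → ℝ≥0∞, Measurable f →
        morreyNorm q (2 / (p - 1)) (T ^ (α / 2)) f ≤ γ → ∀ n, ∀ t ∈ Ioc 0 T,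
          morreyNorm p (2 / (p - 1) * (q / p)) (T ^ (α / 2)) (picard α p f n t) ≤
            K * ENNReal.ofReal (t ^ (-(α * ((1 - q / p) / (p - 1))))) := by
  have hp : 1 < p := hq.trans hqp
  have hp0 : 0 < p := one_pos.trans hp
  have hp1 : 0 < p - 1 := sub_pos.2 hp
  set d := q / p with hd
  set κ := 2 / (p - 1) * d with hκ
  set β := (1 - d) / (p - 1) with hβ
  have hd1 : d < 1 := (div_lt_one hp0).2 hqp
  have hβ0 : 0 < β := div_pos (sub_pos.2 hd1) hp1
  have hβp : β * p < 1 := by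
    rw [hβ, div_mul_eq_mul_div, div_lt_one hp1, hd, sub_mul, div_mul_cancel₀ q hp0.ne']
    linarith
  have hβ1 : β < 1 := (le_mul_of_one_le_right hβ0.le hp.le).trans_lt hβp
  obtain ⟨C₁, hC₁⟩ := exists_morreyNorm_subord_hDensity_le N (q := q) (p := p)
    (κ := 2 / (p - 1)) (κ' := κ) (β := β) hq.le hqp.le (by rw [hκ, hd]; field_simp)
    (by rw [hκ, hβ]; ring) hβ0.le hβ1
  obtain ⟨C₂, hC₂⟩ := exists_morreyNorm_duhamel_le N (p := p) (κ := κ) (b := β * p) (d := d) hp.le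
    (by rw [hκ]; field_simp) hd1 hβp
  obtain ⟨γ, K, hγ, hK⟩ := exists_mul_add_mul_rpow_le hp C₁ C₂
  refine ⟨γ, K, hγ, fun α T hα0 hα1 hT f hf hfγ n t ht => ?_⟩
  have hR : 0 ≤ T ^ (α / 2) := by positivity
  have htR {t : ℝ} (ht : t ∈ Ioc 0 T) : t ^ α ≤ (T ^ (α / 2)) ^ 2 := by
    rw [← Real.rpow_mul_natCast hT.le, Nat.cast_two, div_mul_cancel₀ α two_ne_zero]
    exact Real.rpow_le_rpow ht.1.le ht.2 hα0.le
  have hexp : α * (1 - d - β * p) = -(α * β) := by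
    rw [hβ]
    field_simp
    ring
  refine morreyNorm_picard_le (A := C₁ * γ) (C := C₂) hp.le hf (fun t ht => ?_)
    (fun t ht v L hv hL => ?_) hK n ht
  · rw [ENNReal.coe_mul, mul_right_comm]
    exact (hC₁ α _ t hα0 hα1 hR ht.1 (htR ht) f hf).trans (mul_le_mul_right hfγ _)
  · exact hexp ▸ hC₂ α _ t hα0 hα1 hR ht.1 (htR ht) v L hv hL

lemma exists_isSolution_of_morreyNorm_le (N : ℕ) {q : ℝ} (hq : 1 < q) (hqp : q < p) :
    ∃ γ : ℝ≥0, 0 < γ ∧ ∀ α T : ℝ, 0 < α → α < 1 → 0 < T →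
      ∀ f : EuclideanSpace ℝ (Fin N) → ℝ≥0∞, Measurable f →
        morreyNorm q (2 / (p - 1)) (T ^ (α / 2)) f ≤ γ →
          ∃ u, IsSolution α p T (volume.withDensity f) u := by
  have hp0 : 0 < p := by linarith
  obtain ⟨γ, K, hγ, hbound⟩ := exists_morreyNorm_picard_le N hq hqp
  refine ⟨γ, hγ, fun α T hα0 hα1 hT f hf hfγ =>
    ⟨_, isSolution_picardLimit hp0 hf fun t ht => ?_⟩⟩
  have hmeas (n : ℕ) : Measurable (picard α p f n t) :=
    (measurable_picard hf n).comp measurable_prodMk_left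
  have hsup := (morreyNorm_iSup_le hp0 hmeas fun i j hij => monotone_picard hp0.le hij t).trans
    (iSup_le fun n => hbound α T hα0 hα1 hT f hf hfγ n t ht)
  exact ae_lt_top_of_morreyNorm_ne_top hp0 (by positivity) (Measurable.iSup hmeas)
    (ne_top_of_le_ne_top (ENNReal.mul_ne_top ENNReal.coe_ne_top ENNReal.ofReal_ne_top) hsup)

end Picard

lemma morreyNorm_le_of_lintegral_ball_le {r κ R : ℝ} (hr : 0 < r) {γ : ℝ} {f : E → ℝ≥0∞}
    (h : ∀ σ ∈ Ioc 0 R, ⨆ z : E, (∫⁻ y in Metric.ball z σ, f y ^ r) ^ (1 / r) ≤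
      ENNReal.ofReal (γ * σ ^ ((N : ℝ) / r - κ))) :
    morreyNorm r κ R f ≤
      ENNReal.ofReal γ * (volume (Metric.ball (0 : E) 1) ^ r⁻¹)⁻¹ := by
  refine morreyNorm_le_iff.2 fun z σ hσ => ?_
  have hσ0 := hσ.1
  have hr' : 0 ≤ r⁻¹ := by positivity
  have hvol : volume (Metric.ball z σ) =
      ENNReal.ofReal (σ ^ N) * volume (Metric.ball (0 : E) 1) := by
    rw [Measure.addHaar_ball_of_pos _ _ hσ0, finrank_euclideanSpace_fin]
  have hσN0 : ENNReal.ofReal (σ ^ N) ^ r⁻¹ ≠ 0 :=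
    (ENNReal.rpow_pos (ENNReal.ofReal_pos.2 (by positivity)) ENNReal.ofReal_ne_top).ne'
  have hσN : ENNReal.ofReal (σ ^ N) ^ r⁻¹ ≠ ∞ :=
    ENNReal.rpow_ne_top_of_nonneg hr' ENNReal.ofReal_ne_top
  have hscale : ENNReal.ofReal (σ ^ κ) * ENNReal.ofReal (σ ^ ((N : ℝ) / r - κ)) *
      (ENNReal.ofReal (σ ^ N) ^ r⁻¹)⁻¹ = 1 := by
    rw [ENNReal.ofReal_rpow_of_nonneg (by positivity) hr', ← Real.rpow_natCast_mul hσ0.le,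
      ← ENNReal.ofReal_inv_of_pos (by positivity), ← ENNReal.ofReal_mul (by positivity),
      ← ENNReal.ofReal_mul (by positivity), ← Real.rpow_add hσ0, ← Real.rpow_neg hσ0.le,
      ← Real.rpow_add hσ0, div_eq_mul_inv, add_sub_cancel, add_neg_cancel, Real.rpow_zero,
      ENNReal.ofReal_one]
  have hball : (∫⁻ y in Metric.ball z σ, f y ^ r) ^ r⁻¹ ≤
      ENNReal.ofReal γ * ENNReal.ofReal (σ ^ ((N : ℝ) / r - κ)) := by
    rw [← one_div, ← ENNReal.ofReal_mul' (by positivity)]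
    exact (le_iSup (fun z => (∫⁻ y in Metric.ball z σ, f y ^ r) ^ (1 / r)) z).trans (h σ hσ)
  calc ENNReal.ofReal (σ ^ κ) * (⨍⁻ y in Metric.ball z σ, f y ^ r ∂volume) ^ r⁻¹
      = ENNReal.ofReal (σ ^ κ) * ((∫⁻ y in Metric.ball z σ, f y ^ r) ^ r⁻¹ *
          ((ENNReal.ofReal (σ ^ N) ^ r⁻¹)⁻¹ * (volume (Metric.ball (0 : E) 1) ^ r⁻¹)⁻¹)) := by
        rw [setLAverage_eq, hvol, ENNReal.div_rpow_of_nonneg _ _ hr',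
          ENNReal.mul_rpow_of_nonneg _ _ hr', div_eq_mul_inv,
          ENNReal.mul_inv (Or.inl hσN0) (Or.inl hσN)]
    _ ≤ ENNReal.ofReal (σ ^ κ) * (ENNReal.ofReal γ * ENNReal.ofReal (σ ^ ((N : ℝ) / r - κ)) *
          ((ENNReal.ofReal (σ ^ N) ^ r⁻¹)⁻¹ * (volume (Metric.ball (0 : E) 1) ^ r⁻¹)⁻¹)) := by
        gcongr
    _ = (ENNReal.ofReal (σ ^ κ) * ENNReal.ofReal (σ ^ ((N : ℝ) / r - κ)) *
          (ENNReal.ofReal (σ ^ N) ^ r⁻¹)⁻¹) *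
            (ENNReal.ofReal γ * (volume (Metric.ball (0 : E) 1) ^ r⁻¹)⁻¹) := by ring
    _ = ENNReal.ofReal γ * (volume (Metric.ball (0 : E) 1) ^ r⁻¹)⁻¹ := by rw [hscale, one_mul]

end TimeFractional

theorem theorem1p3_general (N : ℕ) {p r : ℝ} (hp : 1 < p) (hr : 1 < r) :
    ∃ γ : ℝ, 0 < γ ∧ ∀ α T : ℝ, 0 < α → α < 1 → 0 < T →
      ∀ μ : EuclideanSpace ℝ (Fin N) → ℝ≥0∞, AEMeasurable μ →
        (∀ σ ∈ Ioc 0 (T ^ (α / 2)), ⨆ z, (∫⁻ y in Metric.ball z σ, μ y ^ r) ^ (1 / r) ≤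
          ENNReal.ofReal (γ * σ ^ ((N : ℝ) / r - 2 / (p - 1)))) →
        ∃ u, TimeFractional.IsSolution α p T (volume.withDensity μ) u := by
  set q := min r ((1 + p) / 2)
  have hq : 1 < q := lt_min hr (by linarith)
  have hqp : q < p := (min_le_right _ _).trans_lt (by linarith)
  have hr0 : 0 < r := by linarith
  obtain ⟨γ, hγ, hexists⟩ := TimeFractional.exists_isSolution_of_morreyNorm_le N hq hqp
  set V : ℝ≥0∞ := volume (Metric.ball (0 : EuclideanSpace ℝ (Fin N)) 1) ^ r⁻¹
  have hV0 : V ≠ 0 :=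
    (ENNReal.rpow_pos (Metric.measure_ball_pos _ _ one_pos) measure_ball_lt_top.ne).ne'
  have hV : V ≠ ∞ := ENNReal.rpow_ne_top_of_nonneg (by positivity) measure_ball_lt_top.ne
  refine ⟨γ * V.toReal, mul_pos hγ (ENNReal.toReal_pos hV0 hV),
    fun α T hα0 hα1 hT μ hμ hball => ?_⟩
  have hnorm : TimeFractional.morreyNorm q (2 / (p - 1)) (T ^ (α / 2)) (hμ.mk μ) ≤ γ :=
    calc TimeFractional.morreyNorm q (2 / (p - 1)) (T ^ (α / 2)) (hμ.mk μ)
        ≤ TimeFractional.morreyNorm r (2 / (p - 1)) (T ^ (α / 2)) (hμ.mk μ) :=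
          TimeFractional.morreyNorm_le_morreyNorm (by linarith) (min_le_left _ _)
            hμ.measurable_mk
      _ = TimeFractional.morreyNorm r (2 / (p - 1)) (T ^ (α / 2)) μ :=
          (TimeFractional.morreyNorm_congr_ae hμ.ae_eq_mk).symm
      _ ≤ ENNReal.ofReal (γ * V.toReal) * V⁻¹ :=
          TimeFractional.morreyNorm_le_of_lintegral_ball_le hr0 hball
      _ = γ := by
          rw [ENNReal.ofReal_mul γ.coe_nonneg, ENNReal.ofReal_toReal hV, ENNReal.ofReal_coe_nnreal,
            mul_assoc, ENNReal.mul_inv_cancel hV0 hV, mul_one]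
  rw [withDensity_congr_ae hμ.ae_eq_mk]
  exact hexists α T hα0 hα1 hT _ hμ.measurable_mk hnorm

theorem theorem1p3 (N : ℕ) (hN : 1 ≤ N) (p r : ℝ) (hp : 1 + 2 / (N : ℝ) < p) (hr : 1 < r)
    (hpr : 2 * r / (p - 1) < (N : ℝ)) :
    ∃ γ : ℝ → ℝ,
      (∀ α : ℝ, 0 < α → α < 1 →
        0 < γ α ∧
        ∀ T : ℝ, 0 < T →
        ∀ μ : EuclideanSpace ℝ (Fin N) → ℝ, AEMeasurable μ volume → (∀ x, 0 ≤ μ x) →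
          (∀ σ : ℝ, 0 < σ → σ ≤ T ^ (α / 2) →
            ⨆ z : EuclideanSpace ℝ (Fin N),
                (∫⁻ y in Metric.ball z σ, ENNReal.ofReal (μ y ^ r)) ^ (1 / r) ≤
              ENNReal.ofReal (γ α * σ ^ ((N : ℝ) / r - 2 / (p - 1)))) →
          ∃ u : ℝ → EuclideanSpace ℝ (Fin N) → ℝ≥0∞,
            TimeFractional.IsSolution α p T
              (volume.withDensity fun y => ENNReal.ofReal (μ y)) u) ∧
      0 < limsup (fun α : ℝ => (γ α : EReal)) (𝓝[<] 1) ∧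
      limsup (fun α : ℝ => (γ α : EReal)) (𝓝[<] 1) < ⊤ := by
  have hp1 : 1 < p := (le_add_of_nonneg_right (by positivity)).trans_lt hp
  obtain ⟨γ, hγ, hexists⟩ := theorem1p3_general N hp1 hr
  refine ⟨fun _ => γ, fun α hα0 hα1 => ⟨hγ, fun T hT μ hμ hμ0 hball => ?_⟩, ?_, ?_⟩
  · refine hexists α T hα0 hα1 hT _ hμ.ennreal_ofReal fun σ hσ => ?_
    simpa only [ENNReal.ofReal_rpow_of_nonneg (hμ0 _) (one_pos.trans hr).le] using
      hball σ hσ.1 hσ.2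
  · simpa only [limsup_const] using EReal.coe_pos.2 hγ
  · simpa only [limsup_const] using EReal.coe_lt_top γ
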